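/- Let $\Gamma$ be a finite quiver with vertex set $\Omega_0$, and let $\widetilde\Gamma$ be the doubled quiver, with vertex set $\Omega_0$ and edge set $\widetilde\Omega$, obtained by adding to every edge $\gamma$ of $\Gamma$, with tail $t(\gamma)$ and head $h(\gamma)$, a reverse edge $\overline\gamma$ from $h(\gamma)$ to $t(\gamma)$. Fix a dimension vector $v\in\mathbb{N}^{\Omega_0}$ and let $$\mathrm{Rep}(\widetilde\Gamma,v)=\bigoplus_{\gamma\in\widetilde\Omega}\mathrm{Mat}_{\mathbb{C}}(v_{h(\gamma)},v_{t(\gamma)})$$ with its usual topology and the Hermitian norm $\|\phi\|^2=\sum_{\gamma\in\widetilde\Omega}\mathrm{tr}(\phi_\gamma\phi_\gamma^\dagger)$. The group $\mathrm{GL}_v=\prod_{j\in\Omega_0}\mathrm{GL}_{v_j}(\mathbb{C})$ acts on it by $(g.\phi)_\gamma=g_{h(\gamma)}\phi_\gamma g_{t(\gamma)}^{-1}$. The image of the diagonal map $\mathbb{C}^*\to\mathrm{GL}_v$ acts trivially, so the quotient $G_v=\mathrm{GL}_v/\mathbb{C}^*$ acts on $\mathrm{Rep}(\widetilde\Gamma,v)$;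 so does the subgroup $G_v'=\{g\in \mathrm{GL}_v\mid\prod_j\det g_j=1\}$. Let $\theta\in\mathbb{R}^{\Omega_0}$ satisfy $\sum_{j}\theta_jv_j=0$, and let $\chi^\theta$ be the associated real character, with modulus $$|\chi^\theta(g)|=\prod_{j\in\Omega_0}|\det g_j|^{-\theta_j},$$ which is well defined on $G_v$ and on $G_v'$. Let $G$ be $G_v$ or $G_v'$. A point $x_0\in \mathrm{Rep}(\widetilde\Gamma,v)$ is called $\theta$-semistable (for $G$) if there is a point $x\in\overline{G.x_0}$ such that the function $G\to\mathbb{R}$, $g\mapsto \|g.x\|^2-\log\left(|\chi^\theta(g)|^2\right)$, attains its minimum at the identity. It is called $\theta$-stable (for $G$) if it is $\theta$-semistable, its orbit $G.x_0$ is closed in the set of $\theta$-semistable points, and its stabilizer in $G$ is finite. **Theorem.** For each of the two groups $G=G_v$ and $G=G_v'$, a representation $(V,\phi)$ of $\widetilde\Gamma$ with dimension vector $v$, where $V=\bigoplus_{j\in\Omega_0}\mathbb{C}^{v_j}$ and $\phi\in\mathrm{Rep}(\widetilde\Gamma,v)$, is $\theta$-stable if and only if $$\sum_{j\in\Omega_0}\theta_j\dim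 W_j<0$$ for every subrepresentation $W=\bigoplus_j W_j$ of $(V,\phi)$ (graded subspace with $\phi_\gamma(W_{t(\gamma)})\subset W_{h(\gamma)}$ for all $\gamma\in\widetilde\Omega$) different from $0$ and from $V$. -/

import Mathlib

open scoped MatrixGroups

namespace KingReal

/-! ### Stability for a real character, in terms of the Kempf-Ness map

`G` acts on a space `X`, `nsq` is the square of the Hermitian norm on `X`, and `m : G →* ℝ` is the
modulus `g ↦ |χ(g)|` of a real character `χ`. -/

section Stability

/-- The Kempf-Ness map `g ↦ ‖g • x‖² - log (|χ(g)|²)`. -/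
noncomputable def kempfNess {G X : Type*} [Group G] [MulAction G X]
    (nsq : X → ℝ) (m : G →* ℝ) (x : X) (g : G) : ℝ :=
  nsq (g • x) - Real.log (m g ^ 2)

/-- `x₀` is semistable: the closure of its orbit contains a point whose Kempf-Ness map has a
(global) minimum at the identity. -/
def IsSemistable {G X : Type*} [Group G] [TopologicalSpace X] [MulAction G X]
    (nsq : X → ℝ) (m : G →* ℝ) (x₀ : X) : Prop :=
  ∃ x ∈ closure (MulAction.orbit G x₀), ∀ g : G, kempfNess nsq m x 1 ≤ kempfNess nsq m x g

/-- `x₀` is stable: it is semistable, its orbit is closed in the semistable locus, and its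
stabilizer is finite. -/
def IsStable {G X : Type*} [Group G] [TopologicalSpace X] [MulAction G X]
    (nsq : X → ℝ) (m : G →* ℝ) (x₀ : X) : Prop :=
  IsSemistable nsq m x₀ ∧
    IsClosed ((↑) ⁻¹' MulAction.orbit G x₀ : Set {x : X // IsSemistable nsq m x}) ∧
    Finite (MulAction.stabilizer G x₀)

end Stability

/-! ### Representations of a quiver with dimension vector `v` -/

section Representations

/-- The space of complex representations of the quiver `Q` with dimension vector `v`; an arrow
from `a` to `b` is represented by a `v b × v a` matrix. -/
def QRep {Q : Type*} [Quiver Q] (v : Q → ℕ) : Type _ :=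
  ∀ a b : Q, (a ⟶ b) → Matrix (Fin (v b)) (Fin (v a)) ℂ

noncomputable instance {Q : Type*} [Quiver Q] (v : Q → ℕ) : TopologicalSpace (QRep v) :=
  inferInstanceAs
    (TopologicalSpace (∀ a b : Q, (a ⟶ b) → Matrix (Fin (v b)) (Fin (v a)) ℂ))

/-- The square of the Hermitian norm, `∑_γ tr (φ_γ φ_γ†)`. -/
noncomputable def normSq {Q : Type*} [Quiver Q] [Fintype Q] [∀ a b : Q, Fintype (a ⟶ b)]
    {v : Q → ℕ} (φ : QRep v) : ℝ :=
  ∑ a : Q, ∑ b : Q, ∑ γ : a ⟶ b, ((φ a b γ) * (φ a b γ).conjTranspose).trace.re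

/-- A graded subspace `W = ⨁ W_j` of `V = ⨁ ℂ^{v_j}` is a subrepresentation if it is preserved by
all the maps of the representation. -/
def IsSubrep {Q : Type*} [Quiver Q] {v : Q → ℕ} (φ : QRep v)
    (W : ∀ j : Q, Submodule ℂ (Fin (v j) → ℂ)) : Prop :=
  ∀ (a b : Q) (γ : a ⟶ b), ∀ w ∈ W a, (φ a b γ).mulVec w ∈ W b

end Representations

/-! ### The groups acting on the space of representations -/

section Groups

/-- The group `GL_v = ∏_j GL_{v_j}(ℂ)`. -/
abbrev GLv {Q : Type*} (v : Q → ℕ) : Type _ :=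
  ∀ j : Q, GL (Fin (v j)) ℂ

/-- The action `(g • φ)_γ = g_{h(γ)} φ_γ g_{t(γ)}⁻¹`. -/
instance {Q : Type*} [Quiver Q] (v : Q → ℕ) : MulAction (GLv v) (QRep v) where
  smul g φ := fun a b γ => (g b).val * φ a b γ * (g a)⁻¹.val
  one_smul φ := by
    funext a b γ
    change (1 : GL (Fin (v b)) ℂ).val * φ a b γ * (1 : GL (Fin (v a)) ℂ)⁻¹.val = φ a b γ
    simp
  mul_smul g h φ := by
    funext a b γ
    change (g b * h b).val * φ a b γ * (g a * h a)⁻¹.val =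
      (g b).val * ((h b).val * φ a b γ * (h a)⁻¹.val) * (g a)⁻¹.val
    simp only [mul_inv_rev, Units.val_mul, Matrix.mul_assoc]

theorem smul_apply {Q : Type*} [Quiver Q] {v : Q → ℕ} (g : GLv v) (φ : QRep v) (a b : Q)
    (γ : a ⟶ b) : (g • φ) a b γ = (g b).val * φ a b γ * (g a)⁻¹.val := rfl

/-- The diagonal embedding of `ℂˣ` in `GL_v`. -/
def scalarHom {Q : Type*} (v : Q → ℕ) : ℂˣ →* GLv v :=
  MonoidHom.pi fun j => Matrix.GeneralLinearGroup.scalar (Fin (v j))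

/-- The subgroup `ℂˣ` of `GL_v`. -/
def scalars {Q : Type*} (v : Q → ℕ) : Subgroup (GLv v) := (scalarHom v).range

theorem scalarHom_comm {Q : Type*} (v : Q → ℕ) (c : ℂˣ) (g : GLv v) :
    g * scalarHom v c = scalarHom v c * g := by
  funext j
  ext i k
  change ((g j).val * (Matrix.GeneralLinearGroup.scalar (Fin (v j)) c).val) i k =
    ((Matrix.GeneralLinearGroup.scalar (Fin (v j)) c).val * (g j).val) i k
  simp [mul_comm]

instance {Q : Type*} (v : Q → ℕ) : (scalars v).Normal where
  conj_mem := by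
    rintro _ ⟨c, rfl⟩ g
    exact ⟨c, by rw [scalarHom_comm, mul_inv_cancel_right]⟩

/-- The group `G_v = GL_v / ℂˣ`. -/
abbrev Gv {Q : Type*} (v : Q → ℕ) : Type _ := GLv v ⧸ scalars v

theorem scalarHom_smul {Q : Type*} [Quiver Q] (v : Q → ℕ) (c : ℂˣ) (φ : QRep v) :
    scalarHom v c • φ = φ := by
  funext a b γ
  change (Matrix.GeneralLinearGroup.scalar (Fin (v b)) c).val * φ a b γ *
    (Matrix.GeneralLinearGroup.scalar (Fin (v a)) c)⁻¹.val = φ a b γ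
  rw [← map_inv, Matrix.GeneralLinearGroup.coe_scalar, Matrix.GeneralLinearGroup.coe_scalar,
    Matrix.scalar_apply, Matrix.scalar_apply]
  ext i k
  rw [Matrix.mul_diagonal, Matrix.diagonal_mul, mul_right_comm, Units.mul_inv, one_mul]

/-- The action of `G_v` on representations, induced by that of `GL_v`. -/
instance {Q : Type*} [Quiver Q] (v : Q → ℕ) : MulAction (Gv v) (QRep v) :=
  MulAction.compHom (QRep v)
    (QuotientGroup.lift (scalars v) (MulAction.toPermHom (GLv v) (QRep v)) (by
      rintro _ ⟨c, rfl⟩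
      ext φ : 1
      exact scalarHom_smul v c φ) : Gv v →* Equiv.Perm (QRep v))

theorem mk_smul {Q : Type*} [Quiver Q] (v : Q → ℕ) (g : GLv v) (φ : QRep v) :
    (QuotientGroup.mk g : Gv v) • φ = g • φ := rfl

/-- The subgroup `{g ∈ GL_v | ∏_j det g_j = 1}` of `GL_v`. -/
def detOne {Q : Type*} [Fintype Q] (v : Q → ℕ) : Subgroup (GLv v) where
  carrier := {g | ∏ j, (g j).det = 1}
  one_mem' := by simp
  mul_mem' := by
    intro g h hg hh
    simp only [Set.mem_ofPred_eq] at hg hh ⊢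
    simp [Finset.prod_mul_distrib, hg, hh]
  inv_mem' := by
    intro g hg
    simp only [Set.mem_ofPred_eq] at hg ⊢
    simp [Finset.prod_inv_distrib, hg]

end Groups

/-! ### The modulus of the real character `χ^θ` -/

section Character

/-- The modulus `|χ^θ| : g ↦ ∏_j |det g_j| ^ (-θ_j)`, as a homomorphism on `GL_v`. -/
noncomputable def modulus {Q : Type*} [Fintype Q] (v : Q → ℕ) (θ : Q → ℝ) : GLv v →* ℝ where
  toFun g := ∏ j, ‖(g j).val.det‖ ^ (-θ j)
  map_one' := by simp
  map_mul' g h := by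
    simp [Real.mul_rpow, Finset.prod_mul_distrib]

theorem modulus_scalarHom {Q : Type*} [Fintype Q] (v : Q → ℕ) (θ : Q → ℝ)
    (hθ : ∑ j, θ j * v j = 0) (c : ℂˣ) : modulus v θ (scalarHom v c) = 1 := by
  have hc : (0 : ℝ) < ‖(c : ℂ)‖ := norm_pos_iff.2 c.ne_zero
  have h (j : Q) : ‖(scalarHom v c j).val.det‖ ^ (-θ j) = ‖(c : ℂ)‖ ^ (-(θ j * v j)) := by
    change ‖(Matrix.GeneralLinearGroup.scalar (Fin (v j)) c).val.det‖ ^ (-θ j) = _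
    simp only [Matrix.GeneralLinearGroup.coe_scalar, Matrix.scalar_apply, Matrix.det_diagonal,
      Finset.prod_const, Finset.card_univ, Fintype.card_fin, norm_pow]
    rw [← Real.rpow_natCast, ← Real.rpow_mul hc.le]
    ring_nf
  change ∏ j, _ = (1 : ℝ)
  rw [Finset.prod_congr rfl fun j _ => h j, ← Real.rpow_sum_of_pos hc]
  simp [hθ]

/-- The modulus of `χ^θ` on `G_v = GL_v / ℂˣ`; it is well defined because `∑ θ_j v_j = 0`. -/
noncomputable def modulusGv {Q : Type*} [Fintype Q] (v : Q → ℕ) (θ : Q → ℝ)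
    (hθ : ∑ j, θ j * v j = 0) : Gv v →* ℝ :=
  QuotientGroup.lift (scalars v) (modulus v θ) (by
    rintro _ ⟨c, rfl⟩
    exact modulus_scalarHom v θ hθ c)

/-- The modulus of `χ^θ` on `{g ∈ GL_v | ∏_j det g_j = 1}`. -/
noncomputable def modulusDetOne {Q : Type*} [Fintype Q] (v : Q → ℕ) (θ : Q → ℝ) :
    detOne v →* ℝ :=
  (modulus v θ).comp (detOne v).subtype

end Character

/-! ### The doubled quiver of a finite quiver is finite -/

section Doubled

instance {Q : Type*} [Fintype Q] : Fintype (Quiver.Symmetrify Q) := inferInstanceAs (Fintype Q)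

instance {Q : Type*} [Quiver Q] [h : ∀ a b : Q, Fintype (a ⟶ b)]
    (a b : Quiver.Symmetrify Q) : Fintype (a ⟶ b) :=
  @instFintypeSum _ _ (h a b) (h b a)

end Doubled

end KingReal

/-! The method is that of Kempf and Ness, carried out on `GL_v`. Scalars change neither the action
nor the modulus of `χ^θ`, so `GL_v` and both groups `G` have the same orbits and the same semistable
points; only the stabilizers differ, and only by scalars.

Stability gives negativity. The orbit is closed in the semistable locus, so the point with minimal
Kempf-Ness map lies in the orbit itself. There, scaling a subrepresentation `W` by `e^s` and fixing
its orthogonal complement changes the Kempf-Ness map by `(e^{2s} - 1) B + 2 s Θ`, where `Θ = ∑ θ_j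
dim W_j` and `B` is the squared norm of the block from the complement to `W`. Criticality at `s = 0`
forces `Θ = -B ≤ 0` (`sum_nonpos_of_kempfNess_min`). If `Θ = 0`, the complement is a
subrepresentation too, and scaling the two summands differently gives an infinite stabilizer
(`exists_oneParameter_stabilizer`).

Negativity gives stability. Write group elements as `k exp(t) u` with `k`, `u` unitary and `t` real
diagonal. The Kempf-Ness map ignores `k`, and for fixed `u` it is a sum of exponentials in `t` plus
a linear term, hence convex. Along a ray, either some exponential grows, or the sublevel sets of `t`
span subrepresentations, and their negativity makes the linear term positive. As `u` varies in a
compact group, the minimum is attained (`exists_kempfNess_min`). Closedness of the orbit and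
finiteness of the stabilizer are both Schur's lemma: a nonzero map to a representation with no
subrepresentation of positive `θ`-dimension is invertible (`isUnit_of_hom`). -/

namespace KingReal

/-! ### Unitary groups and the singular value decomposition. -/

section LinearAlgebra

instance compactSpace_unitaryGroup (n : ℕ) : CompactSpace (Matrix.unitaryGroup (Fin n) ℂ) := by
  refine isCompact_iff_compactSpace.1 (?_ : IsCompact
    (Matrix.unitaryGroup (Fin n) ℂ : Set (Matrix (Fin n) (Fin n) ℂ)))
  refine IsCompact.of_isClosed_subset (s := Set.univ.pi fun _ : Fin n => Set.univ.pi
    fun _ : Fin n => Metric.closedBall (0 : ℂ) 1) ?_ ?_ ?_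
  · exact isCompact_univ_pi fun _ => isCompact_univ_pi fun _ => isCompact_closedBall _ _
  · have : {A : Matrix (Fin n) (Fin n) ℂ | A * star A = 1} =
        (Matrix.unitaryGroup (Fin n) ℂ : Set (Matrix (Fin n) (Fin n) ℂ)) := by
      ext A
      exact Matrix.mem_unitaryGroup_iff.symm
    exact this ▸ isClosed_eq (by fun_prop) continuous_const
  · intro A hA i _ j _
    simpa using entry_norm_bound_of_unitary hA i j

/-- The invertible matrix `diag (exp t_i)`. -/
noncomputable def expDiag {n : ℕ} (t : Fin n → ℝ) : GL (Fin n) ℂ where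
  val := Matrix.diagonal fun i => (Real.exp (t i) : ℂ)
  inv := Matrix.diagonal fun i => (Real.exp (-t i) : ℂ)
  val_inv := by
    rw [Matrix.diagonal_mul_diagonal, ← Matrix.diagonal_one]
    congr 1; ext i
    rw [← Complex.ofReal_mul, ← Real.exp_add]; simp
  inv_val := by
    rw [Matrix.diagonal_mul_diagonal, ← Matrix.diagonal_one]
    congr 1; ext i
    rw [← Complex.ofReal_mul, ← Real.exp_add]; simp

-- Diagonalise `g† g = w exp(2t) w†`; then `k = g w exp(-t)` is unitary and `u = w†`.
open scoped ComplexOrder in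
theorem exists_unitary_mul_expDiag_mul_unitary {n : ℕ} (g : GL (Fin n) ℂ) :
    ∃ (k u : Matrix.unitaryGroup (Fin n) ℂ) (t : Fin n → ℝ),
      g = Unitary.toUnits k * expDiag t * Unitary.toUnits u := by
  have hpos : (g.val.conjTranspose * g.val).PosDef :=
    Matrix.PosDef.conjTranspose_mul_self _ (Matrix.mulVec_injective_of_isUnit g.isUnit)
  have hH := hpos.isHermitian
  set w := hH.eigenvectorUnitary
  set t : Fin n → ℝ := fun i => Real.log (hH.eigenvalues i) / 2 with ht
  have hdiag : Matrix.diagonal (RCLike.ofReal ∘ hH.eigenvalues) =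
      (expDiag t).val * (expDiag t).val := by
    change _ = Matrix.diagonal (fun i => (Real.exp (t i) : ℂ)) *
      Matrix.diagonal (fun i => (Real.exp (t i) : ℂ))
    rw [Matrix.diagonal_mul_diagonal]
    congr 1; ext i
    rw [← Complex.ofReal_mul, ← Real.exp_add]
    simp [ht, Real.exp_log (hpos.eigenvalues_pos i)]
  have hsp : g.val.conjTranspose * g.val =
      w.val * (expDiag t).val * (expDiag t).val * star w.val := by
    conv_lhs => rw [hH.spectral_theorem, Unitary.conjStarAlgAut_apply, hdiag]
    simp only [w, mul_assoc]
  have hinv : (expDiag t).val * (expDiag t)⁻¹.val = 1 := (expDiag t).mul_inv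
  have hinv' : (expDiag t)⁻¹.val * (expDiag t).val = 1 := (expDiag t).inv_mul
  have hstar : ((expDiag t)⁻¹.val).conjTranspose = (expDiag t)⁻¹.val := by
    change (Matrix.diagonal _).conjTranspose = Matrix.diagonal _
    rw [Matrix.diagonal_conjTranspose]
    congr 1; ext i; exact Complex.conj_ofReal _
  have hw : star w.val * w.val = 1 := Unitary.coe_star_mul_self w
  have hw' : w.val * star w.val = 1 := Unitary.coe_mul_star_self w
  have hk : g.val * w.val * (expDiag t)⁻¹.val ∈ Matrix.unitaryGroup (Fin n) ℂ := by
    rw [Matrix.mem_unitaryGroup_iff', Matrix.star_eq_conjTranspose, Matrix.conjTranspose_mul,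
      Matrix.conjTranspose_mul, hstar]
    calc (expDiag t)⁻¹.val * (w.val.conjTranspose * g.val.conjTranspose) *
          (g.val * w.val * (expDiag t)⁻¹.val)
        = (expDiag t)⁻¹.val * (star w.val * (g.val.conjTranspose * g.val) * w.val) *
          (expDiag t)⁻¹.val := by simp only [mul_assoc, Matrix.star_eq_conjTranspose]
      _ = (expDiag t)⁻¹.val * ((star w.val * w.val) * (expDiag t).val * (expDiag t).val *
          (star w.val * w.val)) * (expDiag t)⁻¹.val := by rw [hsp]; simp only [mul_assoc]
      _ = ((expDiag t)⁻¹.val * (expDiag t).val) * ((expDiag t).val * (expDiag t)⁻¹.val) := by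
        rw [hw]; simp only [mul_assoc, mul_one, one_mul]
      _ = 1 := by rw [hinv, hinv', one_mul]
  refine ⟨⟨_, hk⟩, star w, t, ?_⟩
  ext1
  change g.val = g.val * w.val * (expDiag t)⁻¹.val * (expDiag t).val * star w.val
  rw [mul_assoc (g.val * w.val), hinv', mul_one, mul_assoc, hw', mul_one]

/-- Extend an orthonormal basis of `W` to one of `ℂ^n`; `u` is the passage to coordinates in it,
with `W` on the first `dim W` coordinates. -/
theorem exists_unitary_mem_iff {n : ℕ} (W : Submodule ℂ (Fin n → ℂ)) :
    ∃ u : Matrix.unitaryGroup (Fin n) ℂ, ∀ w, w ∈ W ↔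
      ∀ i : Fin n, Module.finrank ℂ W ≤ i → u.val.mulVec w i = 0 := by
  set d := Module.finrank ℂ W with hd
  let W' : Submodule ℂ (EuclideanSpace ℂ (Fin n)) :=
    W.comap (WithLp.linearEquiv 2 ℂ (Fin n → ℂ)).toLinearMap
  have hd' : Module.finrank ℂ W' = d := by
    refine LinearEquiv.finrank_eq (LinearEquiv.ofSubmodule' (WithLp.linearEquiv 2 ℂ (Fin n → ℂ)) W)
  let e := (stdOrthonormalBasis ℂ W').reindex (finCongr hd')
  let f : Fin n → EuclideanSpace ℂ (Fin n) := fun i =>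
    if h : (i : ℕ) < d then (e ⟨i, h⟩ : EuclideanSpace ℂ (Fin n)) else 0
  have hf : Orthonormal ℂ (({i : Fin n | (i : ℕ) < d}).domRestrict f) := by
    have := (e.orthonormal.comp_linearIsometry W'.subtypeₗᵢ).comp
      (fun i : {i : Fin n | (i : ℕ) < d} => (⟨i.1, i.2⟩ : Fin d))
      (fun i j h => by simpa [Fin.ext_iff, Subtype.ext_iff] using h)
    convert this using 1
    ext i : 1
    have hi : (i.1 : ℕ) < d := i.2
    change f i.1 = _
    simp [f, hi]
  obtain ⟨b, hb⟩ := hf.exists_orthonormalBasis_extension_of_card_eq (by simp)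
  have hbW : ∀ i : Fin n, (i : ℕ) < d → b i ∈ W' := fun i hi => by
    rw [hb i hi]; simp [f, hi]
  have hmem : ∀ w : EuclideanSpace ℂ (Fin n), w ∈ W' ↔
      ∀ i : Fin n, d ≤ i → inner ℂ (b i) w = 0 := by
    intro w
    constructor
    · intro hw i hi
      have := e.sum_repr ⟨w, hw⟩
      have h2 := congrArg (Subtype.val) this
      change inner ℂ (b i) (⟨w, hw⟩ : W').1 = 0
      rw [← h2]
      simp only [Submodule.coe_sum, Submodule.coe_smul, inner_sum, inner_smul_right]
      refine Finset.sum_eq_zero fun j _ => ?_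
      have hj : (j : ℕ) < n := lt_of_lt_of_le j.2 (hi.trans i.2.le)
      have hbj : b ⟨j, hj⟩ = e j := by
        rw [hb ⟨j, hj⟩ j.2]; simp [f]
      rw [← hbj, b.orthonormal.2 (by intro h; subst h; exact absurd j.2 (not_lt.2 hi)), mul_zero]
    · intro h
      rw [← b.sum_repr w]
      refine Submodule.sum_mem _ fun i _ => ?_
      by_cases hi : (i : ℕ) < d
      · exact Submodule.smul_mem _ _ (hbW i hi)
      · rw [b.repr_apply_apply, h i (not_lt.1 hi), zero_smul]; exact Submodule.zero_mem _
  refine ⟨⟨_, b.toMatrix_orthonormalBasis_mem_unitary (EuclideanSpace.basisFun (Fin n) ℂ)⟩,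
    fun w => ?_⟩
  have hw : w ∈ W ↔ WithLp.toLp 2 w ∈ W' := Iff.rfl
  rw [hw, hmem]
  refine forall₂_congr fun i _ => ?_
  have : (b.toBasis.toMatrix (EuclideanSpace.basisFun (Fin n) ℂ)).mulVec w i =
      inner ℂ (b i) (WithLp.toLp 2 w) := by
    conv_rhs => rw [← (EuclideanSpace.basisFun (Fin n) ℂ).sum_repr (WithLp.toLp 2 w)]
    simp only [inner_sum, inner_smul_right, Matrix.mulVec, dotProduct, Module.Basis.toMatrix_apply]
    refine Finset.sum_congr rfl fun k _ => ?_
    rw [EuclideanSpace.basisFun_repr, OrthonormalBasis.coe_toBasis_repr_apply,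
      OrthonormalBasis.repr_apply_apply, mul_comm]
  rw [this]

end LinearAlgebra

/-! ### Abel summation over sublevel sets, and minima of functions convex along rays. -/

section Minimum

/-- If the sums of `θ` over the proper nonempty sublevel sets of `t` are negative, and the total
sum vanishes, then `∑ θ t` is positive unless `t` is constant. -/
theorem sum_mul_pos_of_sublevel_neg {ι : Type*} [Fintype ι] (θ t : ι → ℝ) (h0 : ∑ i, θ i = 0)
    (h : ∀ c i j, t i ≤ c → c < t j → ∑ i with t i ≤ c, θ i < 0) {i j : ι} (hij : t i < t j) :
    0 < ∑ i, θ i * t i := by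
  classical
  induction hN : (Finset.univ.image t).card using Nat.strong_induction_on generalizing t i j with
  | _ N ih =>
  subst hN
  obtain ⟨m, -, hm⟩ := Finset.exists_max_image Finset.univ t ⟨i, Finset.mem_univ i⟩
  have him : t i < t m := hij.trans_le (hm j (Finset.mem_univ j))
  obtain ⟨l, hl, hlmax⟩ := Finset.exists_max_image (Finset.univ.filter fun k => t k < t m) t
    ⟨i, by simp [him]⟩
  simp only [Finset.mem_filter, Finset.mem_univ, true_and] at hl hlmax
  -- Lower the largest value `t m` to the second largest `t l`. This removes one value, so induction
  -- applies, and the sum drops by `-(t m - t l)` times the `θ`-sum of a proper sublevel set.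
  let s : ι → ℝ := fun k => min (t k) (t l)
  have hst : ∀ k, θ k * t k = θ k * s k + (t m - t l) * (θ k - if t k ≤ t l then θ k else 0) := by
    intro k
    by_cases hk : t k ≤ t l
    · simp [s, hk]
    · have : t k = t m := le_antisymm (hm k (Finset.mem_univ k))
        (not_lt.1 fun h' => hk (hlmax k h'))
      rw [if_neg hk, this, show s k = t l from min_eq_right (not_le.1 hk).le]
      ring
  have hsum : ∑ k, θ k * t k = ∑ k, θ k * s k - (t m - t l) * ∑ k with t k ≤ t l, θ k := by
    simp_rw [hst]
    rw [Finset.sum_add_distrib, ← Finset.mul_sum, Finset.sum_sub_distrib, h0, Finset.sum_filter]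
    ring
  have hneg := h (t l) l m le_rfl hl
  have hs : 0 ≤ ∑ k, θ k * s k := by
    by_cases hc : ∃ a b, s a < s b
    · obtain ⟨a, b, hab⟩ := hc
      refine (ih _ ?_ s ?_ hab rfl).le
      · apply Finset.card_lt_card
        rw [Finset.ssubset_iff_of_subset]
        · refine ⟨t m, by simp, ?_⟩
          simp only [Finset.mem_image, Finset.mem_univ, true_and, not_exists]
          intro k hk
          have hle := min_le_right (t k) (t l)
          rw [show min (t k) (t l) = t m from hk] at hle
          exact absurd hle (not_le.2 hl)
        · intro x hx
          simp only [Finset.mem_image, Finset.mem_univ, true_and] at hx ⊢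
          obtain ⟨k, rfl⟩ := hx
          rcases min_choice (t k) (t l) with h' | h'
          · exact ⟨k, h'.symm⟩
          · exact ⟨l, h'.symm⟩
      · intro c a b hac hcb
        have hcl : c < t l := hcb.trans_le (min_le_right _ _)
        have hiff : ∀ k, s k ≤ c ↔ t k ≤ c := fun k => by
          simp only [s, min_le_iff]
          exact or_iff_left (not_le.2 hcl)
        simp only [hiff]
        exact h c a b ((hiff a).1 hac) (hcb.trans_le (min_le_left _ _))
    · push Not at hc
      have : ∀ k, θ k * s k = θ k * s i := fun k => by rw [le_antisymm (hc i k) (hc k i)]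
      simp_rw [this]
      rw [← Finset.sum_mul, h0, zero_mul]
  have : (t m - t l) * ∑ k with t k ≤ t l, θ k < 0 := mul_neg_of_pos_of_neg (sub_pos.2 hl) hneg
  linarith

/-- A continuous function that is convex along rays and exceeds its value at the origin somewhere
on each ray attains its minimum. -/
theorem exists_forall_le_of_convexOn_rays {K E : Type*} [TopologicalSpace K] [CompactSpace K]
    [Nonempty K] [NormedAddCommGroup E] [NormedSpace ℝ E] [FiniteDimensional ℝ E]
    (F : K → E → ℝ) (hF : Continuous fun p : K × E => F p.1 p.2) (c : ℝ) (h0 : ∀ k, F k 0 = c)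
    (hconv : ∀ k e, ConvexOn ℝ Set.univ fun s : ℝ => F k (s • e))
    (hray : ∀ k e, e ≠ 0 → ∃ s : ℝ, 0 < s ∧ c < F k (s • e)) :
    ∃ k e, ∀ k' e', F k e ≤ F k' e' := by
  have : ProperSpace E := FiniteDimensional.proper ℝ E
  -- By convexity, a ray that has once exceeded its initial value `c` stays above it.
  have hmono : ∀ k e (s r : ℝ), 0 < s → s ≤ r → c < F k (s • e) → c < F k (r • e) := by
    intro k e s r hs hsr h
    have hr : 0 < r := hs.trans_le hsr
    have hsr' : s / r ≤ 1 := (div_le_one hr).2 hsr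
    have hsr0 : 0 < s / r := by positivity
    have := (hconv k e).2 (Set.mem_univ 0) (Set.mem_univ r) (sub_nonneg.2 hsr') hsr0.le (by ring)
    simp only [smul_eq_mul, mul_zero, zero_add, div_mul_cancel₀ _ hr.ne', zero_smul, h0] at this
    have h2 : s / r * c < s / r * F k (r • e) := by nlinarith
    exact lt_of_mul_lt_mul_left h2 hsr0.le
  -- Compactness of the directions gives one radius beyond which `F` exceeds `c` everywhere, so it
  -- suffices to minimise over a ball.
  obtain ⟨N, hN⟩ := (isCompact_univ.prod (isCompact_sphere (0 : E) 1)).elim_directed_cover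
    (fun n : ℕ => {p : K × E | c < F p.1 (((n : ℝ) + 1) • p.2)})
    (fun n => isOpen_lt continuous_const
      (hF.comp (continuous_fst.prodMk (continuous_snd.const_smul ((n : ℝ) + 1)))))
    (by
      rintro ⟨k, e⟩ ⟨-, he⟩
      have he' : e ≠ 0 := by
        rintro rfl
        simp at he
      obtain ⟨s, hs, h⟩ := hray k e he'
      obtain ⟨n, hn⟩ := exists_nat_ge s
      exact Set.mem_iUnion.2 ⟨n, hmono k e s _ hs (hn.trans (by linarith)) h⟩)
    (by
      apply Monotone.directed_le
      rintro m n hmn ⟨k, e⟩ h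
      exact hmono k e _ _ (by positivity) (by gcongr) h)
  have hmem0 (k : K) : (k, (0 : E)) ∈ Set.univ ×ˢ Metric.closedBall (0 : E) (N + 1) := by
    simp only [Set.mem_prod, Set.mem_univ, true_and, Metric.mem_closedBall, dist_self]
    positivity
  obtain ⟨⟨k, e⟩, -, hmin⟩ :=
    (isCompact_univ.prod (isCompact_closedBall (0 : E) (N + 1))).exists_isMinOn
    ⟨_, hmem0 (Classical.arbitrary K)⟩
    hF.continuousOn
  refine ⟨k, e, fun k' e' => ?_⟩
  by_cases he : ‖e'‖ ≤ N + 1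
  · exact hmin (show (k', e') ∈ _ by simpa using he)
  · have hn : 0 < ‖e'‖ := lt_of_lt_of_le (by positivity) (not_le.1 he).le
    have h1 : F k e ≤ c := by
      have := hmin (hmem0 k)
      simpa [h0] using this
    have h2 := hN (show (k', ‖e'‖⁻¹ • e') ∈ _ by simp [norm_smul, hn.ne'])
    have h3 := hmono k' _ _ ‖e'‖ (by positivity) (not_le.1 he).le h2
    rw [smul_smul, mul_inv_cancel₀ hn.ne', one_smul] at h3
    exact h1.trans h3.le

end Minimum
-- The Kempf-Ness map on unitary and diagonal elements, and its criticality at a minimum.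
section KempfNess

theorem kempfNess_mul {G X : Type*} [Group G] [MulAction G X] (nsq : X → ℝ) (m : G →* ℝ)
    (x : X) (g h : G) :
    kempfNess nsq m x (g * h) = kempfNess nsq m (h • x) g - Real.log (m h ^ 2) := by
  have hm (a : G) : m a ^ 2 ≠ 0 := pow_ne_zero _ fun h0 => by
    have := map_mul m a a⁻¹
    rw [mul_inv_cancel, map_one, h0, zero_mul] at this
    exact one_ne_zero this
  rw [kempfNess, kempfNess, map_mul, mul_pow, Real.log_mul (hm g) (hm h), mul_smul]
  ring

/-- Moving the base point translates the argument and adds a constant, so a minimum at `g` becomes a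
minimum at the identity for `g • x`. -/
theorem kempfNess_smul_min_iff {G X : Type*} [Group G] [MulAction G X] (nsq : X → ℝ) (m : G →* ℝ)
    (x : X) (g : G) : (∀ h, kempfNess nsq m (g • x) 1 ≤ kempfNess nsq m (g • x) h) ↔
      ∀ h, kempfNess nsq m x g ≤ kempfNess nsq m x h := by
  constructor
  · intro H h
    have := H (h * g⁻¹)
    have h1 := kempfNess_mul nsq m x (h * g⁻¹) g
    have h2 := kempfNess_mul nsq m x 1 g
    rw [inv_mul_cancel_right] at h1
    rw [one_mul] at h2
    linarith
  · intro H h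
    have := H (h * g)
    have h1 := kempfNess_mul nsq m x h g
    have h2 := kempfNess_mul nsq m x 1 g
    rw [one_mul] at h2
    linarith

variable {Q : Type*} {v : Q → ℕ}

/-- The tuple of matrices `diag (exp t)`. -/
noncomputable def expDiagV (t : ∀ j : Q, Fin (v j) → ℝ) : GLv v := fun j => expDiag (t j)

/-- A tuple of unitary matrices as an element of `GL_v`. -/
def unitaryV (u : ∀ j : Q, Matrix.unitaryGroup (Fin (v j)) ℂ) : GLv v :=
  fun j => Unitary.toUnits (u j)

theorem det_expDiag {n : ℕ} (t : Fin n → ℝ) :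
    (expDiag t).val.det = (Real.exp (∑ i, t i) : ℂ) := by
  change (Matrix.diagonal _).det = _
  rw [Matrix.det_diagonal, Real.exp_sum, Complex.ofReal_prod]

theorem modulus_unitaryV [Fintype Q] (θ : Q → ℝ) (u : ∀ j : Q, Matrix.unitaryGroup (Fin (v j)) ℂ) :
    modulus v θ (unitaryV u) = 1 := by
  refine Finset.prod_eq_one fun j _ => ?_
  have : ‖(unitaryV u j).val.det‖ = 1 :=
    CStarRing.norm_of_mem_unitary (Matrix.det_of_mem_unitary (u j).2)
  rw [this, Real.one_rpow]

theorem modulus_expDiagV [Fintype Q] (θ : Q → ℝ) (t : ∀ j : Q, Fin (v j) → ℝ) :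
    modulus v θ (expDiagV t) = Real.exp (-∑ j, θ j * ∑ i, t j i) := by
  rw [← Finset.sum_neg_distrib, Real.exp_sum]
  refine Finset.prod_congr rfl fun j _ => ?_
  change ‖(expDiag (t j)).val.det‖ ^ _ = _
  rw [det_expDiag, Complex.norm_real, Real.norm_of_nonneg (Real.exp_pos _).le, ← Real.exp_mul]
  ring_nf

theorem exists_unitaryV_mul_expDiagV_mul_unitaryV (g : GLv v) :
    ∃ k t u, g = unitaryV k * expDiagV t * unitaryV u := by
  choose k u t h using fun j => exists_unitary_mul_expDiag_mul_unitary (g j)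
  exact ⟨k, t, u, funext h⟩

variable [Quiver Q]

/-- The positions of matrix entries of a representation. -/
abbrev Entry (v : Q → ℕ) : Type _ := Σ a : Q, Σ b : Q, Σ _ : a ⟶ b, Fin (v b) × Fin (v a)

/-- The matrix entry of a representation at a given position. -/
def entry (φ : QRep v) (p : Entry v) : ℂ := φ p.1 p.2.1 p.2.2.1 p.2.2.2.1 p.2.2.2.2

/-- The weight of a matrix entry under the diagonal one-parameter group with exponents `t`. -/
def entryWeight (t : ∀ j : Q, Fin (v j) → ℝ) (p : Entry v) : ℝ :=
  t p.2.1 p.2.2.2.1 - t p.1 p.2.2.2.2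

theorem entry_expDiagV_smul (t : ∀ j : Q, Fin (v j) → ℝ) (φ : QRep v) (p : Entry v) :
    entry (expDiagV t • φ) p = (Real.exp (entryWeight t p) : ℂ) * entry φ p := by
  obtain ⟨a, b, γ, i, k⟩ := p
  change (Matrix.diagonal _ * φ a b γ * Matrix.diagonal _ : Matrix _ _ ℂ) i k = _
  rw [Matrix.mul_diagonal, Matrix.diagonal_mul, entryWeight, sub_eq_add_neg, Real.exp_add,
    Complex.ofReal_mul, entry]
  ring

variable [Fintype Q] [∀ a b : Q, Fintype (a ⟶ b)]

theorem normSq_eq_sum_entry (φ : QRep v) : normSq φ = ∑ p : Entry v, ‖entry φ p‖ ^ 2 := by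
  rw [normSq, Fintype.sum_sigma]
  refine Finset.sum_congr rfl fun a _ => ?_
  rw [Fintype.sum_sigma]
  refine Finset.sum_congr rfl fun b _ => ?_
  rw [Fintype.sum_sigma]
  refine Finset.sum_congr rfl fun γ _ => ?_
  rw [Fintype.sum_prod_type, Matrix.trace, Complex.re_sum]
  refine Finset.sum_congr rfl fun i _ => ?_
  rw [Matrix.diag_apply, Matrix.mul_apply, Complex.re_sum]
  refine Finset.sum_congr rfl fun k _ => ?_
  rw [Matrix.conjTranspose_apply, Complex.star_def, Complex.mul_conj, Complex.ofReal_re,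
    Complex.normSq_eq_norm_sq]
  rfl

theorem normSq_unitaryV_smul (u : ∀ j : Q, Matrix.unitaryGroup (Fin (v j)) ℂ) (φ : QRep v) :
    normSq (unitaryV u • φ) = normSq φ := by
  refine Finset.sum_congr rfl fun a _ => Finset.sum_congr rfl fun b _ =>
    Finset.sum_congr rfl fun γ _ => ?_
  congr 1
  have hs : (unitaryV u • φ) a b γ = (u b).val * φ a b γ * star (u a).val := rfl
  have ha : star (u a).val * (u a).val = 1 := Unitary.coe_star_mul_self _
  have hb : star (u b).val * (u b).val = 1 := Unitary.coe_star_mul_self _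
  rw [hs, Matrix.conjTranspose_mul, Matrix.conjTranspose_mul, ← Matrix.star_eq_conjTranspose
    (star (u a).val), star_star, Matrix.trace_mul_comm]
  calc _ = ((u a).val * (φ a b γ).conjTranspose * ((star (u b).val * (u b).val)) * φ a b γ *
        star (u a).val).trace := by simp only [Matrix.mul_assoc, Matrix.star_eq_conjTranspose]
    _ = _ := by
      rw [hb, Matrix.mul_one, Matrix.trace_mul_comm, ← Matrix.mul_assoc, ← Matrix.mul_assoc, ha,
        Matrix.one_mul, Matrix.trace_mul_comm]

theorem kempfNess_mul_unitaryV (θ : Q → ℝ) (φ : QRep v) (g : GLv v)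
    (u : ∀ j : Q, Matrix.unitaryGroup (Fin (v j)) ℂ) :
    kempfNess normSq (modulus v θ) φ (g * unitaryV u) =
      kempfNess normSq (modulus v θ) (unitaryV u • φ) g := by
  rw [kempfNess_mul, modulus_unitaryV]; simp

theorem kempfNess_unitaryV_mul (θ : Q → ℝ) (φ : QRep v) (g : GLv v)
    (u : ∀ j : Q, Matrix.unitaryGroup (Fin (v j)) ℂ) :
    kempfNess normSq (modulus v θ) φ (unitaryV u * g) = kempfNess normSq (modulus v θ) φ g := by
  rw [kempfNess, kempfNess, map_mul, modulus_unitaryV, mul_smul, normSq_unitaryV_smul, one_mul]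

theorem kempfNess_expDiagV (θ : Q → ℝ) (φ : QRep v) (t : ∀ j : Q, Fin (v j) → ℝ) :
    kempfNess normSq (modulus v θ) φ (expDiagV t) =
      ∑ p, Real.exp (2 * entryWeight t p) * ‖entry φ p‖ ^ 2 + 2 * ∑ j, θ j * ∑ i, t j i := by
  rw [kempfNess, modulus_expDiagV, ← Real.exp_nat_mul, Real.log_exp, normSq_eq_sum_entry]
  simp only [entry_expDiagV_smul, norm_mul, mul_pow, Complex.norm_real, Real.norm_eq_abs, sq_abs]
  simp only [← Real.exp_nat_mul]
  push_cast
  ring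

/-- If the Kempf-Ness map of `φ` is minimal at the identity, then every subrepresentation, put in
standard position by a unitary `u`, has nonpositive `θ`-dimension, and if this is zero, then the
standard complement is a subrepresentation too. -/
theorem sum_nonpos_of_kempfNess_min (θ : Q → ℝ) (φ : QRep v)
    (hmin : ∀ g, kempfNess normSq (modulus v θ) φ 1 ≤ kempfNess normSq (modulus v θ) φ g)
    (u : ∀ j : Q, Matrix.unitaryGroup (Fin (v j)) ℂ) (d : Q → ℕ) (hd : ∀ j, d j ≤ v j)
    (h : ∀ p : Entry v, d p.2.1 ≤ p.2.2.2.1 → (p.2.2.2.2 : ℕ) < d p.1 →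
      entry (unitaryV u • φ) p = 0) :
    ∑ j, θ j * d j ≤ 0 ∧ (∑ j, θ j * d j = 0 → ∀ p : Entry v, (p.2.2.2.1 : ℕ) < d p.2.1 →
      d p.1 ≤ p.2.2.2.2 → entry (unitaryV u • φ) p = 0) := by
  classical
  set y := unitaryV u • φ with hy
  -- The one-parameter group scaling the standard subspace by `e^s`. Only the block from the
  -- complement to the subspace, of squared norm `B`, is rescaled; the opposite block vanishes by
  -- hypothesis.
  let t (s : ℝ) (j : Q) (i : Fin (v j)) : ℝ := if (i : ℕ) < d j then s else 0
  let P (p : Entry v) : Prop := (p.2.2.2.1 : ℕ) < d p.2.1 ∧ d p.1 ≤ p.2.2.2.2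
  set B : ℝ := ∑ p : Entry v, if P p then ‖entry y p‖ ^ 2 else 0 with hB
  set Θ : ℝ := ∑ j, θ j * d j with hΘ
  have ht (s : ℝ) : ∑ j, θ j * ∑ i, t s j i = s * Θ := by
    rw [hΘ, Finset.mul_sum]
    refine Finset.sum_congr rfl fun j _ => ?_
    have : ∑ i, t s j i = d j * s := by
      simp only [t, Finset.sum_ite, Finset.sum_const_zero, add_zero, Finset.sum_const, nsmul_eq_mul,
        Fin.card_filter_val_lt, min_eq_right (hd j)]
    rw [this]; ring
  have hsum (s : ℝ) : ∑ p, Real.exp (2 * entryWeight (t s) p) * ‖entry y p‖ ^ 2 =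
      ∑ p, ‖entry y p‖ ^ 2 + (Real.exp (2 * s) - 1) * B := by
    rw [hB, Finset.mul_sum, ← Finset.sum_add_distrib]
    refine Finset.sum_congr rfl fun p _ => ?_
    by_cases h1 : (p.2.2.2.1 : ℕ) < d p.2.1 <;> by_cases h2 : (p.2.2.2.2 : ℕ) < d p.1
    · simp [P, entryWeight, t, h1, h2]
    · simp only [P, entryWeight, t, h1, h2, not_lt.1 h2, if_true, if_false, true_and, sub_zero]
      ring
    · rw [h p (not_lt.1 h1) h2]; simp
    · simp [P, entryWeight, t, h1, h2]
  have hle (s : ℝ) : 0 ≤ (Real.exp (2 * s) - 1) * B + 2 * (s * Θ) := by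
    have h1 := hmin (expDiagV (t s) * unitaryV u)
    rw [kempfNess_mul_unitaryV, kempfNess_expDiagV, ht, ← hy, hsum,
      ← kempfNess_unitaryV_mul θ φ 1 u, mul_one, ← one_mul (unitaryV u), kempfNess_mul_unitaryV,
      ← hy, kempfNess, one_smul, map_one, normSq_eq_sum_entry] at h1
    simp only [one_pow, Real.log_one, sub_zero] at h1
    linarith
  have hder : HasDerivAt (fun s : ℝ => (Real.exp (2 * s) - 1) * B + 2 * (s * Θ))
      (2 * B + 2 * Θ) 0 := by
    have h1 : HasDerivAt (fun s : ℝ => 2 * s) 2 0 := by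
      simpa using (hasDerivAt_id (0 : ℝ)).const_mul 2
    have h2 := (((h1.exp.sub_const 1).mul_const B).add
      (((hasDerivAt_id (0 : ℝ)).mul_const Θ).const_mul 2))
    simp only [mul_zero, Real.exp_zero, one_mul] at h2
    exact h2
  -- The function in `hle` vanishes at `s = 0` and is nonnegative for both signs of `s`.
  have hzero : 2 * B + 2 * Θ = 0 := by
    refine IsLocalMin.hasDerivAt_eq_zero (Filter.Eventually.of_forall fun s => ?_) hder
    simpa using hle s
  have hBnn : ∀ p ∈ Finset.univ, (0 : ℝ) ≤ if P p then ‖entry y p‖ ^ 2 else 0 := fun p _ => by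
    split_ifs <;> positivity
  have hB0 : 0 ≤ B := Finset.sum_nonneg hBnn
  refine ⟨by linarith, fun h0 p h1 h2 => ?_⟩
  have hBz : B = 0 := by linarith
  have := (Finset.sum_eq_zero_iff_of_nonneg hBnn).1 hBz p (Finset.mem_univ p)
  rw [if_pos ⟨h1, h2⟩] at this
  simpa using this

end KempfNess
-- Existence of a minimum of the Kempf-Ness map.
section Existence

/-- Every proper nonzero subrepresentation has negative `θ`-dimension. -/
def SubrepsNeg {Q : Type*} [Quiver Q] [Fintype Q] {v : Q → ℕ} (θ : Q → ℝ) (φ : QRep v) : Prop :=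
  ∀ W : ∀ j, Submodule ℂ (Fin (v j) → ℂ), IsSubrep φ W → W ≠ ⊥ → W ≠ ⊤ →
    ∑ j, θ j * (Module.finrank ℂ (W j) : ℝ) < 0

/-- The subspace mapped by `u` onto the span of the basis vectors `e_i` with `P i`. -/
def coordSubmodule {n : ℕ} (u : Matrix.unitaryGroup (Fin n) ℂ) (P : Fin n → Prop) :
    Submodule ℂ (Fin n → ℂ) :=
  (⨅ i ∈ {i | ¬ P i}, LinearMap.ker (LinearMap.proj i : (Fin n → ℂ) →ₗ[ℂ] ℂ)).comap
    (Matrix.mulVecLin u.val)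

theorem mem_coordSubmodule {n : ℕ} {u : Matrix.unitaryGroup (Fin n) ℂ} {P : Fin n → Prop}
    {w : Fin n → ℂ} : w ∈ coordSubmodule u P ↔ ∀ i, ¬ P i → u.val.mulVec w i = 0 := by
  simp [coordSubmodule, Submodule.mem_iInf]

theorem finrank_coordSubmodule {n : ℕ} (u : Matrix.unitaryGroup (Fin n) ℂ) (P : Fin n → Prop)
    [DecidablePred P] :
    Module.finrank ℂ (coordSubmodule u P) = (Finset.univ.filter P).card := by
  classical
  let e : (Fin n → ℂ) ≃ₗ[ℂ] (Fin n → ℂ) := LinearEquiv.ofLinearMap (Matrix.mulVecLin u.val)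
    (Matrix.mulVecLin (star u.val))
    (by rw [← Matrix.mulVecLin_mul, (Matrix.mem_unitaryGroup_iff).1 u.2, Matrix.mulVecLin_one])
    (by rw [← Matrix.mulVecLin_mul, (Matrix.mem_unitaryGroup_iff').1 u.2, Matrix.mulVecLin_one])
  have h1 : Module.finrank ℂ (coordSubmodule u P) = Module.finrank ℂ
      (⨅ i ∈ {i | ¬ P i}, LinearMap.ker (LinearMap.proj i : (Fin n → ℂ) →ₗ[ℂ] ℂ) :
        Submodule ℂ (Fin n → ℂ)) :=
    LinearEquiv.finrank_eq (e.ofSubmodule' _)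
  rw [h1, (LinearMap.iInfKerProjEquiv ℂ (fun _ : Fin n => ℂ) (I := {i | P i}) (J := {i | ¬ P i})
    (Set.disjoint_left.2 fun i hi hj => hj hi)
    (fun i _ => Classical.em (P i))).finrank_eq]
  simp [Fintype.card_subtype]

variable {Q : Type*} {v : Q → ℕ} [Quiver Q]

/-- Turns vanishing of a block of matrix entries into a subrepresentation; used with `P` a sublevel
set of the exponents `t`. -/
theorem isSubrep_coordSubmodule (φ : QRep v) (u : ∀ j : Q, Matrix.unitaryGroup (Fin (v j)) ℂ)
    (P : ∀ j : Q, Fin (v j) → Prop)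
    (h : ∀ p : Entry v, ¬ P p.2.1 p.2.2.2.1 → P p.1 p.2.2.2.2 → entry (unitaryV u • φ) p = 0) :
    IsSubrep φ fun j => coordSubmodule (u j) (P j) := by
  intro a b γ w hw
  rw [mem_coordSubmodule] at hw ⊢
  intro i hi
  have h1 : (u b).val.mulVec ((φ a b γ).mulVec w) =
      ((unitaryV u • φ) a b γ).mulVec ((u a).val.mulVec w) := by
    have ha : star (u a).val * (u a).val = 1 := Unitary.coe_star_mul_self _
    change _ = ((u b).val * φ a b γ * star (u a).val).mulVec _
    rw [Matrix.mulVec_mulVec, Matrix.mulVec_mulVec, Matrix.mul_assoc, ha, Matrix.mul_one]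
  rw [h1, Matrix.mulVec, dotProduct]
  refine Finset.sum_eq_zero fun k _ => ?_
  by_cases hk : P a k
  · have := h ⟨a, b, γ, i, k⟩ hi hk
    rw [show (unitaryV u • φ) a b γ i k = 0 from this, zero_mul]
  · rw [hw k hk, mul_zero]

theorem entryWeight_smul (s : ℝ) (t : ∀ j : Q, Fin (v j) → ℝ) (p : Entry v) :
    entryWeight (s • t) p = s * entryWeight t p := by
  simp [entryWeight, mul_sub]

theorem continuous_apply_arrow (a b : Q) (γ : a ⟶ b) : Continuous fun φ : QRep v => φ a b γ :=
  (continuous_apply γ).comp ((continuous_apply b).comp (continuous_apply a))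

theorem continuous_entry_unitaryV_smul (p : Entry v) : Continuous
    fun x : (∀ j : Q, Matrix.unitaryGroup (Fin (v j)) ℂ) × QRep v =>
      entry (unitaryV x.1 • x.2) p := by
  obtain ⟨a, b, γ, i, k⟩ := p
  have : Continuous fun x : (∀ j : Q, Matrix.unitaryGroup (Fin (v j)) ℂ) × QRep v =>
      (x.1 b).val * x.2 a b γ * star (x.1 a).val := by
    refine (Continuous.matrix_mul ?_
      ((continuous_apply_arrow a b γ).comp continuous_snd)).matrix_mul ?_
    · fun_prop
    · fun_prop
  exact this.matrix_elem i k

variable [Fintype Q] [∀ a b : Q, Fintype (a ⟶ b)]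

theorem convexOn_sum_exp {ι : Type*} [Fintype ι] (a c : ι → ℝ) (hc : ∀ i, 0 ≤ c i) (l : ℝ) :
    ConvexOn ℝ Set.univ fun s : ℝ => ∑ i, Real.exp (s * a i) * c i + s * l := by
  refine ⟨convex_univ, fun x _ y _ r s hr hs hrs => ?_⟩
  have h (i : ι) : Real.exp ((r * x + s * y) * a i) * c i ≤
      r * (Real.exp (x * a i) * c i) + s * (Real.exp (y * a i) * c i) := by
    have := convexOn_exp.2 (Set.mem_univ (x * a i)) (Set.mem_univ (y * a i)) hr hs hrs
    simp only [smul_eq_mul] at this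
    have h2 := mul_le_mul_of_nonneg_right this (hc i)
    rw [show (r * x + s * y) * a i = r * (x * a i) + s * (y * a i) by ring]
    linarith
  have h2 := Finset.sum_le_sum fun i (_ : i ∈ Finset.univ) => h i
  rw [Finset.sum_add_distrib, ← Finset.mul_sum, ← Finset.mul_sum] at h2
  simp only [smul_eq_mul]
  linarith

/-- The Kempf-Ness map grows along every nontrivial ray. -/
theorem exists_lt_kempfNess_ray {θ : Q → ℝ} (hθ : ∑ j, θ j * v j = 0) {φ : QRep v}
    (hφ : SubrepsNeg θ φ) (u : ∀ j : Q, Matrix.unitaryGroup (Fin (v j)) ℂ)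
    (t : ∀ j : Q, Fin (v j) → ℝ) (ht : t ≠ 0) (ht0 : ∑ j, ∑ i, t j i = 0) (c : ℝ) :
    ∃ s : ℝ, 0 < s ∧ c < ∑ p, Real.exp (s * (2 * entryWeight t p)) * ‖entry (unitaryV u • φ) p‖ ^ 2 +
      s * (2 * ∑ j, θ j * ∑ i, t j i) := by
  classical
  set L := ∑ j, θ j * ∑ i, t j i with hL
  by_cases hcase : ∃ p : Entry v, 0 < entryWeight t p ∧ entry (unitaryV u • φ) p ≠ 0
  · obtain ⟨p, hp, hne⟩ := hcase
    set δ := entryWeight t p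
    set ε := ‖entry (unitaryV u • φ) p‖ ^ 2 with hε
    have hε0 : 0 < ε := by positivity
    set A := 2 * ε * δ ^ 2 with hA
    have hA0 : 0 < A := by positivity
    -- Since `exp x ≥ x² / 2`, the growing entry contributes at least `s (A s)`. This `s` makes `A s
    -- + 2 L > |c|`, and `s ≥ 1` then gives `s (A s + 2 L) > c`.
    refine ⟨(2 * |L| + |c| + 1) / A + 1, by positivity, ?_⟩
    set s := (2 * |L| + |c| + 1) / A + 1 with hs
    have hs1 : 1 ≤ s := by rw [hs]; linarith [show 0 ≤ (2 * |L| + |c| + 1) / A by positivity]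
    have hAs : A * s = 2 * |L| + |c| + 1 + A := by rw [hs]; field_simp
    have h1 : Real.exp (s * (2 * δ)) * ε ≤
        ∑ p, Real.exp (s * (2 * entryWeight t p)) * ‖entry (unitaryV u • φ) p‖ ^ 2 :=
      Finset.single_le_sum (f := fun p : Entry v => Real.exp (s * (2 * entryWeight t p)) *
        ‖entry (unitaryV u • φ) p‖ ^ 2) (fun _ _ => by positivity) (Finset.mem_univ p)
    have h2 : (s * (2 * δ)) ^ 2 / 2 ≤ Real.exp (s * (2 * δ)) := by
      have := Real.quadratic_le_exp_of_nonneg (x := s * (2 * δ)) (by positivity)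
      have h3 : 0 ≤ s * (2 * δ) := by positivity
      linarith
    have h3 : s * (A * s) ≤ Real.exp (s * (2 * δ)) * ε := by
      have := mul_le_mul_of_nonneg_right h2 hε0.le
      rw [hA]; linarith
    have h4 : c < s * (A * s + 2 * L) := by
      have h5 : |c| < A * s + 2 * L := by
        rw [hAs]; linarith [neg_abs_le L]
      calc c ≤ |c| := le_abs_self c
        _ < A * s + 2 * L := h5
        _ ≤ s * (A * s + 2 * L) := le_mul_of_one_le_left ((abs_nonneg c).trans h5.le) hs1
    linarith
  · push Not at hcase
    -- No nonzero entry has positive weight, so none leads out of a sublevel set of `t`: these sets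
    -- span subrepresentations, with negative `θ`-sums. Since `t` is nonzero with sum zero, it is
    -- not constant.
    have hLpos : 0 < L := by
      let θ' : (Σ j : Q, Fin (v j)) → ℝ := fun x => θ x.1
      let t' : (Σ j : Q, Fin (v j)) → ℝ := fun x => t x.1 x.2
      have hnc : ∃ x y, t' x < t' y := by
        by_contra! hc
        refine ht (funext fun j => funext fun i => ?_)
        have hcst : ∀ x, t' x = t' ⟨j, i⟩ := fun x => le_antisymm (hc _ _) (hc _ _)
        have : ∑ x, t' x = 0 := by rw [Fintype.sum_sigma]; exact ht0
        simp only [hcst, Finset.sum_const, nsmul_eq_mul] at this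
        rcases mul_eq_zero.1 this with h | h
        · have : Nonempty (Σ j : Q, Fin (v j)) := ⟨⟨j, i⟩⟩
          exact absurd h (Nat.cast_ne_zero.2 Fintype.card_ne_zero)
        · exact h
      obtain ⟨x, y, hxy⟩ := hnc
      have hpos := sum_mul_pos_of_sublevel_neg θ' t'
        (by
          rw [Fintype.sum_sigma, ← hθ]
          exact Finset.sum_congr rfl fun j _ => by simp [θ', mul_comm])
        (by
          rintro r ⟨j, i⟩ ⟨j', i'⟩ hi hi'
          have hsub := isSubrep_coordSubmodule φ u (fun j i => t j i ≤ r) (fun p h1 h2 =>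
            hcase p (sub_pos.2 (h2.trans_lt (not_le.1 h1))))
          have hfin (j : Q) : Module.finrank ℂ (coordSubmodule (u j) fun i => t j i ≤ r) =
            (Finset.univ.filter fun i => t j i ≤ r).card := finrank_coordSubmodule _ _
          have := hφ _ hsub
            (by
              intro h
              have h1 := hfin j
              rw [show coordSubmodule (u j) (fun i => t j i ≤ r) = ⊥ from congrFun h j,
                finrank_bot] at h1
              exact Finset.card_ne_zero_of_mem (show i ∈ _ by simpa using hi) h1.symm)
            (by
              intro h
              have h1 := hfin j'
              rw [show coordSubmodule (u j') (fun i => t j' i ≤ r) = ⊤ from congrFun h j',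
                finrank_top, Module.finrank_fin_fun] at h1
              have h2 : (Finset.univ.filter fun i => t j' i ≤ r) = Finset.univ :=
                (Finset.card_eq_iff_eq_univ _).1 (by simpa using h1.symm)
              have h3 : i' ∈ (Finset.univ.filter fun i => t j' i ≤ r) := by
                rw [h2]; exact Finset.mem_univ i'
              exact absurd (Finset.mem_filter.1 h3).2 (not_le.2 hi'))
          rw [Finset.sum_filter, Fintype.sum_sigma]
          refine lt_of_eq_of_lt (Finset.sum_congr rfl fun j _ => ?_) this
          rw [hfin j, ← Finset.sum_filter]
          simp [θ', t', mul_comm])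
        hxy
      rw [Fintype.sum_sigma] at hpos
      simpa only [θ', t', hL, Finset.mul_sum] using hpos
    refine ⟨(|c| + 1) / (2 * L), by positivity, ?_⟩
    have h1 : (|c| + 1) / (2 * L) * (2 * L) = |c| + 1 := by field_simp
    rw [h1]
    have h2 : 0 ≤ ∑ p, Real.exp ((|c| + 1) / (2 * L) * (2 * entryWeight t p)) *
      ‖entry (unitaryV u • φ) p‖ ^ 2 := Finset.sum_nonneg fun _ _ => by positivity
    linarith [le_abs_self c]

theorem exists_kempfNess_min {θ : Q → ℝ} (hθ : ∑ j, θ j * v j = 0) {φ : QRep v}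
    (hφ : SubrepsNeg θ φ) : ∃ g : GLv v, ∀ h,
      kempfNess normSq (modulus v θ) φ g ≤ kempfNess normSq (modulus v θ) φ h := by
  -- Restricting to trace zero removes the scalar direction, along which the Kempf-Ness map is
  -- constant.
  let E : Submodule ℝ (∀ j : Q, Fin (v j) → ℝ) :=
    LinearMap.ker (∑ j, ∑ i, (LinearMap.proj i : (Fin (v j) → ℝ) →ₗ[ℝ] ℝ) ∘ₗ
      (LinearMap.proj j : (∀ j : Q, Fin (v j) → ℝ) →ₗ[ℝ] (Fin (v j) → ℝ)))
  have hE (t) : t ∈ E ↔ ∑ j, ∑ i, t j i = 0 := by simp [E]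
  let F (u : ∀ j : Q, Matrix.unitaryGroup (Fin (v j)) ℂ) (t : ∀ j : Q, Fin (v j) → ℝ) : ℝ :=
    kempfNess normSq (modulus v θ) φ (expDiagV t * unitaryV u)
  have hF (u) (t) : F u t = ∑ p, Real.exp (2 * entryWeight t p) *
      ‖entry (unitaryV u • φ) p‖ ^ 2 + 2 * ∑ j, θ j * ∑ i, t j i := by
    rw [← kempfNess_expDiagV, ← kempfNess_mul_unitaryV]
  have hFs (u) (s : ℝ) (t) : F u (s • t) = ∑ p, Real.exp (s * (2 * entryWeight t p)) *
      ‖entry (unitaryV u • φ) p‖ ^ 2 + s * (2 * ∑ j, θ j * ∑ i, t j i) := by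
    rw [hF]
    congr 1
    · exact Finset.sum_congr rfl fun p _ => by rw [entryWeight_smul]; ring_nf
    · simp only [Pi.smul_apply, smul_eq_mul, Finset.mul_sum]
      refine Finset.sum_congr rfl fun j _ => Finset.sum_congr rfl fun i _ => by ring
  obtain ⟨u, t, hmin⟩ := exists_forall_le_of_convexOn_rays
    (K := ∀ j : Q, Matrix.unitaryGroup (Fin (v j)) ℂ) (E := E) (fun u t => F u t)
    (by
      simp only [hF, entryWeight]
      have := fun p => (continuous_entry_unitaryV_smul p).comp
        ((continuous_fst (X := ∀ j : Q, Matrix.unitaryGroup (Fin (v j)) ℂ) (Y := E)).prodMk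
          (continuous_const (y := φ)))
      have h2 (j : Q) (i : Fin (v j)) : Continuous fun p :
          (∀ j : Q, Matrix.unitaryGroup (Fin (v j)) ℂ) × E => (p.2 : ∀ j, Fin (v j) → ℝ) j i :=
        (continuous_apply i).comp ((continuous_apply j).comp
          (continuous_subtype_val.comp continuous_snd))
      refine (continuous_finsetSum _ fun p _ => ?_).add (continuous_const.mul
        (continuous_finsetSum _ fun j _ => continuous_const.mul
          (continuous_finsetSum _ fun i _ => h2 j i)))
      exact (Real.continuous_exp.comp (continuous_const.mul ((h2 _ _).sub (h2 _ _)))).mul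
        ((this p).norm.pow 2))
    (normSq φ)
    (fun u => by
      rw [hF, ← normSq_unitaryV_smul u, normSq_eq_sum_entry]
      simp [entryWeight])
    (fun u t => by
      simp only [Submodule.coe_smul, hFs]
      exact convexOn_sum_exp _ _ (fun _ => by positivity) _)
    (fun u t ht => by
      simp only [Submodule.coe_smul, hFs]
      exact exists_lt_kempfNess_ray hθ hφ u t (by simpa using ht) ((hE _).1 t.2) _)
  refine ⟨expDiagV t * unitaryV u, fun h => ?_⟩
  obtain ⟨k, t', u', rfl⟩ := exists_unitaryV_mul_expDiagV_mul_unitaryV h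
  rw [mul_assoc, kempfNess_unitaryV_mul]
  set N : ℝ := ∑ j, (v j : ℝ) with hN
  -- Subtracting the mean brings `t'` into `E`. Weights are differences of exponents and `∑ θ_j v_j
  -- = 0`, so `F` is unchanged.
  set m : ℝ := (∑ j, ∑ i, t' j i) / N with hm
  let t'' : ∀ j : Q, Fin (v j) → ℝ := fun j i => t' j i - m
  have hsum (j : Q) : ∑ i, t'' j i = ∑ i, t' j i - v j * m := by
    simp [t'', Finset.sum_sub_distrib]
  have ht'' : t'' ∈ E := by
    rw [hE]
    simp only [hsum]
    rw [Finset.sum_sub_distrib, ← Finset.sum_mul, ← hN, hm]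
    by_cases h0 : N = 0
    · have hv (j : Q) : v j = 0 := by
        have := (Finset.sum_eq_zero_iff_of_nonneg fun _ _ => Nat.cast_nonneg _).1 (hN ▸ h0) j
          (Finset.mem_univ j)
        exact_mod_cast this
      rw [h0, zero_mul, sub_zero]
      exact Finset.sum_eq_zero fun j _ => Finset.sum_eq_zero fun i _ =>
        absurd i.2 (by simp [hv j])
    · field_simp; ring
  have heq : F u' t' = F u' t'' := by
    rw [hF, hF]
    congr 1
    · exact Finset.sum_congr rfl fun p _ => by simp [entryWeight, t'']
    · simp only [hsum, mul_sub, Finset.sum_sub_distrib, ← mul_assoc, ← Finset.sum_mul, hθ]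
      simp
  exact (hmin u' ⟨t'', ht''⟩).trans_eq heq.symm

end Existence
-- Subrepresentations in standard position, and Schur's lemma.
section Subrepresentations

variable {Q : Type*} {v : Q → ℕ} [Quiver Q]

theorem isSubrep_map_smul {φ : QRep v} {W : ∀ j : Q, Submodule ℂ (Fin (v j) → ℂ)}
    (hW : IsSubrep φ W) (g : GLv v) :
    IsSubrep (g • φ) fun j => (W j).map (Matrix.mulVecLin (g j).val) := by
  rintro a b γ _ ⟨w, hw, rfl⟩
  refine ⟨(φ a b γ).mulVec w, hW a b γ w hw, ?_⟩
  have : (g a)⁻¹.val * (g a).val = 1 := (g a).inv_mul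
  rw [smul_apply, Matrix.mulVecLin_apply, Matrix.mulVecLin_apply, Matrix.mulVec_mulVec,
    Matrix.mulVec_mulVec, Matrix.mul_assoc, this, Matrix.mul_one]

theorem finrank_map_mulVecLin {n : ℕ} (W : Submodule ℂ (Fin n → ℂ)) (g : GL (Fin n) ℂ) :
    Module.finrank ℂ (W.map (Matrix.mulVecLin g.val)) = Module.finrank ℂ W :=
  (Submodule.equivMapOfInjective _ (Matrix.mulVec_injective_of_isUnit g.isUnit) W).finrank_eq.symm

/-- A subrepresentation can be put in standard position by a tuple of unitary matrices. -/
theorem exists_unitaryV_entry_eq_zero {φ : QRep v} {W : ∀ j : Q, Submodule ℂ (Fin (v j) → ℂ)}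
    (hW : IsSubrep φ W) : ∃ u : ∀ j : Q, Matrix.unitaryGroup (Fin (v j)) ℂ, ∀ p : Entry v,
      Module.finrank ℂ (W p.2.1) ≤ p.2.2.2.1 → (p.2.2.2.2 : ℕ) < Module.finrank ℂ (W p.1) →
        entry (unitaryV u • φ) p = 0 := by
  choose u hu using fun j => exists_unitary_mem_iff (W j)
  refine ⟨u, ?_⟩
  rintro ⟨a, b, γ, i, k⟩ hi hk
  have ha : (u a).val * star (u a).val = 1 := Unitary.coe_mul_star_self _
  have hmem : (star (u a).val).mulVec (Pi.single k 1) ∈ W a := by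
    rw [hu]
    intro l hl
    rw [Matrix.mulVec_mulVec, ha, Matrix.one_mulVec, Pi.single_eq_of_ne]
    rintro rfl
    exact absurd hk (not_lt.2 hl)
  have := (hu b _).1 (hW a b γ _ hmem) i hi
  rw [Matrix.mulVec_mulVec, Matrix.mulVec_mulVec, Matrix.mulVec_single_one] at this
  rw [Matrix.mul_assoc] at this
  change ((u b).val * φ a b γ * star (u a).val) i k = 0
  rw [Matrix.mul_assoc]
  exact this

variable [Fintype Q]

/-- A nonzero homomorphism from a stable to a semistable representation is invertible. -/
theorem isUnit_of_hom {θ : Q → ℝ} (hθ : ∑ j, θ j * v j = 0) {φ y : QRep v} (hφ : SubrepsNeg θ φ)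
    (hy : ∀ W, IsSubrep y W → ∑ j, θ j * (Module.finrank ℂ (W j) : ℝ) ≤ 0)
    {h : ∀ j : Q, Matrix (Fin (v j)) (Fin (v j)) ℂ}
    (hh : ∀ a b (γ : a ⟶ b), h b * φ a b γ = y a b γ * h a) (hne : h ≠ 0) (j : Q) :
    IsUnit (h j) := by
  have hker : IsSubrep φ fun j => LinearMap.ker (Matrix.mulVecLin (h j)) := by
    intro a b γ w hw
    rw [LinearMap.mem_ker, Matrix.mulVecLin_apply] at hw ⊢
    rw [Matrix.mulVec_mulVec, hh, ← Matrix.mulVec_mulVec, hw, Matrix.mulVec_zero]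
  have hran : IsSubrep y fun j => LinearMap.range (Matrix.mulVecLin (h j)) := by
    rintro a b γ _ ⟨w, rfl⟩
    refine ⟨(φ a b γ).mulVec w, ?_⟩
    rw [Matrix.mulVecLin_apply, Matrix.mulVecLin_apply, Matrix.mulVec_mulVec, hh,
      ← Matrix.mulVec_mulVec]
  -- By rank-nullity the `θ`-dimensions of kernel and image cancel, so a proper nonzero kernel would
  -- give `y` a subrepresentation of positive `θ`-dimension.
  have hsum : ∑ j, θ j * (Module.finrank ℂ (LinearMap.range (Matrix.mulVecLin (h j))) : ℝ) +
      ∑ j, θ j * (Module.finrank ℂ (LinearMap.ker (Matrix.mulVecLin (h j))) : ℝ) = 0 := by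
    rw [← Finset.sum_add_distrib, ← hθ]
    refine Finset.sum_congr rfl fun j _ => ?_
    rw [← mul_add, ← Nat.cast_add, LinearMap.finrank_range_add_finrank_ker, Module.finrank_fin_fun]
  by_cases hb : (fun j => LinearMap.ker (Matrix.mulVecLin (h j))) = ⊥
  · rw [← Matrix.mulVec_injective_iff_isUnit]
    exact LinearMap.ker_eq_bot.1 (congrFun hb j)
  · exfalso
    have h1 := hφ _ hker hb fun ht => hne (funext fun j => by
      have : Matrix.mulVecLin (h j) = 0 := LinearMap.ker_eq_top.1 (congrFun ht j)
      exact Matrix.toLin'.injective (by simpa [Matrix.toLin'_apply'] using this))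
    have h2 := hy _ hran
    linarith

theorem sum_finrank_nonpos {θ : Q → ℝ} (hθ : ∑ j, θ j * v j = 0) {φ : QRep v}
    (hφ : SubrepsNeg θ φ) (W : ∀ j : Q, Submodule ℂ (Fin (v j) → ℂ)) (hW : IsSubrep φ W) :
    ∑ j, θ j * (Module.finrank ℂ (W j) : ℝ) ≤ 0 := by
  by_cases hb : W = ⊥
  · subst hb; simp
  by_cases ht : W = ⊤
  · subst ht; simp [hθ]
  exact (hφ W hW hb ht).le

/-- For an eigenvalue `c` of one component of `g`, the endomorphism `c - g` is not invertible, hence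
zero by Schur's lemma. -/
theorem stabilizer_le_scalars {θ : Q → ℝ} (hθ : ∑ j, θ j * v j = 0) {φ : QRep v}
    (hφ : SubrepsNeg θ φ) : MulAction.stabilizer (GLv v) φ ≤ scalars v := by
  intro g hg
  by_cases hv : ∀ j, v j = 0
  · refine ⟨1, funext fun j => Units.ext (Matrix.ext fun i => absurd i.2 (by simp [hv j]))⟩
  push Not at hv
  obtain ⟨j₀, hj₀⟩ := hv
  have : NeZero (v j₀) := ⟨hj₀⟩
  obtain ⟨c, hc⟩ := spectrum.nonempty_of_isAlgClosed_of_finiteDimensional ℂ (g j₀).val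
  let h : ∀ j : Q, Matrix (Fin (v j)) (Fin (v j)) ℂ := fun j => algebraMap ℂ _ c - (g j).val
  have hgc (a b : Q) (γ : a ⟶ b) : (g b).val * φ a b γ = φ a b γ * (g a).val := by
    have h1 : (g b).val * φ a b γ * (g a)⁻¹.val = φ a b γ :=
      congrArg (fun ψ : QRep v => ψ a b γ) (MulAction.mem_stabilizer_iff.1 hg)
    have h2 : (g a)⁻¹.val * (g a).val = 1 := (g a).inv_mul
    conv_rhs => rw [← h1]
    rw [Matrix.mul_assoc, h2, Matrix.mul_one]
  have h0 : h = 0 := by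
    by_contra hne
    refine hc (isUnit_of_hom hθ hφ (sum_finrank_nonpos hθ hφ) (h := h) (fun a b γ => ?_) hne j₀)
    simp only [h]
    rw [Matrix.sub_mul, Matrix.mul_sub, hgc]
    simp [Algebra.algebraMap_eq_smul_one]
  have hgj (j : Q) : (g j).val = algebraMap ℂ _ c := (sub_eq_zero.1 (congrFun h0 j)).symm
  have hc0 : c ≠ 0 := by
    rintro rfl
    have := (g j₀).ne_zero
    rw [hgj, map_zero] at this
    exact this rfl
  refine ⟨Units.mk0 c hc0, funext fun j => Units.ext ?_⟩
  rw [hgj]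
  rfl

end Subrepresentations

/-! ### Limits of orbit points. -/

section Closedness

variable {Q : Type*} {v : Q → ℕ} [Quiver Q] [Fintype Q] [∀ a b : Q, Fintype (a ⟶ b)]

instance : T2Space (QRep v) :=
  inferInstanceAs (T2Space (∀ a b : Q, (a ⟶ b) → Matrix (Fin (v b)) (Fin (v a)) ℂ))

/-- Each point of the orbit of `y` has a subrepresentation with the dimensions of `W`. Put it in
standard position by a unitary: compactness of the unitary group carries the vanishing block over to
the minimal point `z` of the orbit closure, where criticality applies. -/
theorem sum_finrank_nonpos_of_isSemistable {θ : Q → ℝ} {y : QRep v}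
    (hy : IsSemistable normSq (modulus v θ) y) (W : ∀ j : Q, Submodule ℂ (Fin (v j) → ℂ))
    (hW : IsSubrep y W) : ∑ j, θ j * (Module.finrank ℂ (W j) : ℝ) ≤ 0 := by
  obtain ⟨z, hz, hmin⟩ := hy
  obtain ⟨𝓕, hF, hFz⟩ := mem_closure_iff_ultrafilter.1 hz
  -- Made total, with the value `1` off the orbit, so that the ultrafilter can be pushed forward
  -- along `u`.
  have hex : ∀ x : QRep v, ∃ u : ∀ j : Q, Matrix.unitaryGroup (Fin (v j)) ℂ,
      x ∈ MulAction.orbit (GLv v) y → ∀ p : Entry v,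
        Module.finrank ℂ (W p.2.1) ≤ p.2.2.2.1 → (p.2.2.2.2 : ℕ) < Module.finrank ℂ (W p.1) →
          entry (unitaryV u • x) p = 0 := by
    intro x
    by_cases hx : x ∈ MulAction.orbit (GLv v) y
    · obtain ⟨g, rfl⟩ := hx
      obtain ⟨u, hu⟩ := exists_unitaryV_entry_eq_zero (isSubrep_map_smul hW g)
      simp only [finrank_map_mulVecLin] at hu
      exact ⟨u, fun _ => hu⟩
    · exact ⟨1, fun h => absurd h hx⟩
  choose u hu using hex
  obtain ⟨u₀, -, hu₀⟩ := isCompact_univ.ultrafilter_le_nhds (𝓕.map u)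
    (by rw [Filter.principal_univ]; exact le_top)
  have hd (j : Q) : Module.finrank ℂ (W j) ≤ v j :=
    (Submodule.finrank_le _).trans_eq (Module.finrank_fin_fun ℂ)
  have hzero (p : Entry v) (h1 : Module.finrank ℂ (W p.2.1) ≤ p.2.2.2.1)
      (h2 : (p.2.2.2.2 : ℕ) < Module.finrank ℂ (W p.1)) : entry (unitaryV u₀ • z) p = 0 := by
    have hpair : Filter.Tendsto (fun x => (u x, x)) 𝓕 (nhds (u₀, z)) :=
      Filter.Tendsto.prodMk_nhds hu₀ hFz
    have hlim := ((continuous_entry_unitaryV_smul p).tendsto (u₀, z)).comp hpair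
    refine tendsto_nhds_unique hlim (tendsto_const_nhds.congr' ?_)
    filter_upwards [hF] with x hx
    exact (hu x hx p h1 h2).symm
  exact (sum_nonpos_of_kempfNess_min θ z hmin u₀ _ hd hzero).1

/-- The orbit of a stable representation is closed in the semistable locus. -/
theorem mem_orbit_of_mem_closure {θ : Q → ℝ} (hθ : ∑ j, θ j * v j = 0) {φ y : QRep v}
    (hφ : SubrepsNeg θ φ) (hy : IsSemistable normSq (modulus v θ) y)
    (hcl : y ∈ closure (MulAction.orbit (GLv v) φ)) : y ∈ MulAction.orbit (GLv v) φ := by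
  by_cases hv : ∀ j, v j = 0
  · refine ⟨1, funext fun a => funext fun b => funext fun γ => Matrix.ext fun i =>
      absurd i.2 (by simp [hv b])⟩
  push Not at hv
  obtain ⟨j₀, hj₀⟩ := hv
  have : NeZero (v j₀) := ⟨hj₀⟩
  obtain ⟨𝓕, hF, hFy⟩ := mem_closure_iff_ultrafilter.1 hcl
  -- Group elements may diverge, but rescaled to norm one they still intertwine `φ` and `x`. A limit
  -- on the unit sphere is a nonzero homomorphism from `φ` to `y`, though not obviously invertible.
  have hex : ∀ x : QRep v, ∃ h : ∀ j : Q, Fin (v j) → Fin (v j) → ℂ, ‖h‖ = 1 ∧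
      (x ∈ MulAction.orbit (GLv v) φ → ∀ a b (γ : a ⟶ b),
        (Matrix.of (h b)) * φ a b γ = x a b γ * Matrix.of (h a)) := by
    have key : ∀ g : GLv v, ∃ h : ∀ j : Q, Fin (v j) → Fin (v j) → ℂ, ‖h‖ = 1 ∧
        (∀ a b (γ : a ⟶ b), (Matrix.of (h b)) * φ a b γ = (g • φ) a b γ * Matrix.of (h a)) := by
      intro g
      let h : ∀ j : Q, Fin (v j) → Fin (v j) → ℂ := fun j => (g j).val
      have hne : ‖h‖ ≠ 0 := norm_ne_zero_iff.2 fun h0 => (g j₀).ne_zero (congrFun h0 j₀)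
      refine ⟨((‖h‖⁻¹ : ℝ) : ℂ) • h, by rw [norm_smul]; simp [hne], fun a b γ => ?_⟩
      change (((‖h‖⁻¹ : ℝ) : ℂ) • (g b).val) * φ a b γ =
        ((g b).val * φ a b γ * (g a)⁻¹.val) * (((‖h‖⁻¹ : ℝ) : ℂ) • (g a).val)
      have h2 : (g a)⁻¹.val * (g a).val = 1 := (g a).inv_mul
      rw [Matrix.smul_mul, Matrix.mul_smul, Matrix.mul_assoc _ _ (g a).val, h2, Matrix.mul_one]
    intro x
    by_cases hx : x ∈ MulAction.orbit (GLv v) φ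
    · obtain ⟨g, rfl⟩ := hx
      obtain ⟨h, h1, h2⟩ := key g
      exact ⟨h, h1, fun _ => h2⟩
    · obtain ⟨h, h1, -⟩ := key 1
      exact ⟨h, h1, fun h' => absurd h' hx⟩
  choose h hnorm hh using hex
  obtain ⟨h₀, hh₀, hlim⟩ := (isCompact_sphere (0 : ∀ j : Q, Fin (v j) → Fin (v j) → ℂ)
    1).ultrafilter_le_nhds (𝓕.map h) (by
      rw [Filter.le_principal_iff]
      exact Filter.mem_map.2 (Filter.Eventually.of_forall fun x => by simpa using hnorm x))
  have hcont (j : Q) : Continuous fun h : ∀ j : Q, Fin (v j) → Fin (v j) → ℂ =>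
    (Matrix.of (h j) : Matrix (Fin (v j)) (Fin (v j)) ℂ) := continuous_apply j
  have hhom : ∀ a b (γ : a ⟶ b), Matrix.of (h₀ b) * φ a b γ = y a b γ * Matrix.of (h₀ a) := by
    intro a b γ
    have hl : Continuous fun p : (∀ j : Q, Fin (v j) → Fin (v j) → ℂ) × QRep v =>
        Matrix.of (p.1 b) * φ a b γ :=
      ((hcont b).comp continuous_fst).matrix_mul continuous_const
    have hr : Continuous fun p : (∀ j : Q, Fin (v j) → Fin (v j) → ℂ) × QRep v =>
        p.2 a b γ * Matrix.of (p.1 a) :=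
      Continuous.matrix_mul ((continuous_apply_arrow a b γ).comp continuous_snd)
        ((hcont a).comp continuous_fst)
    have hpair : Filter.Tendsto (fun x => (h x, x)) 𝓕 (nhds (h₀, y)) :=
      Filter.Tendsto.prodMk_nhds (show Filter.Tendsto h 𝓕 (nhds h₀) from hlim) hFy
    refine tendsto_nhds_unique ((hl.tendsto _).comp hpair)
      (((hr.tendsto _).comp hpair).congr' ?_)
    filter_upwards [hF] with x hx
    exact (hh x hx a b γ).symm
  have hunit := isUnit_of_hom hθ hφ (sum_finrank_nonpos_of_isSemistable hy)
    (h := fun j => Matrix.of (h₀ j)) hhom (by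
      intro h0
      have : h₀ = 0 := h0
      simp [this] at hh₀)
  choose g hg using hunit
  refine ⟨g, funext fun a => funext fun b => funext fun γ => ?_⟩
  have h2 : (g a).val * (g a)⁻¹.val = 1 := (g a).mul_inv
  change (g b).val * φ a b γ * (g a)⁻¹.val = y a b γ
  rw [hg b, hhom, Matrix.mul_assoc, ← hg a, h2, Matrix.mul_one]

end Closedness
-- Passing between groups with the same transformations.
section Comparison

theorem isClosed_preimage_val_iff_of_subset {X : Type*} [TopologicalSpace X] {P : X → Prop}
    {S : Set X} (hS : ∀ x ∈ S, P x) :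
    IsClosed ((↑) ⁻¹' S : Set {x // P x}) ↔ ∀ y, P y → y ∈ closure S → y ∈ S := by
  have h : {x | P x} ∩ S = S := Set.inter_eq_right.2 hS
  have := isClosed_preimage_val (X := X) (s := {x | P x}) (t := S)
  rw [h] at this
  exact this.trans ⟨fun H y h1 h2 => H ⟨h1, h2⟩, fun H y hy => H y hy.1 hy.2⟩

theorem IsSemistable.smul {G X : Type*} [Group G] [TopologicalSpace X] [MulAction G X]
    {nsq : X → ℝ} {m : G →* ℝ} {x : X} (h : IsSemistable nsq m x) (g : G) :
    IsSemistable nsq m (g • x) := by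
  rwa [IsSemistable, MulAction.orbit_eq_iff.2 (MulAction.mem_orbit x g)]

variable {G H X : Type*} [Group G] [Group H] [MulAction G X] [MulAction H X]

theorem orbit_eq_of_forall_exists_smul_eq (hGH : ∀ g : G, ∃ h : H, ∀ x : X, h • x = g • x)
    (hHG : ∀ h : H, ∃ g : G, ∀ x : X, g • x = h • x) (x : X) :
    MulAction.orbit G x = MulAction.orbit H x := by
  ext y
  constructor
  · rintro ⟨g, rfl⟩
    obtain ⟨h, hh⟩ := hGH g
    exact ⟨h, hh x⟩
  · rintro ⟨h, rfl⟩
    obtain ⟨g, hg⟩ := hHG h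
    exact ⟨g, hg x⟩

/-- Semistability depends only on the transformations of the space, with their moduli. -/
theorem isSemistable_iff_of_forall_exists_smul_eq [TopologicalSpace X] {m : G →* ℝ} {m' : H →* ℝ}
    (hGH : ∀ g : G, ∃ h : H, (∀ x : X, h • x = g • x) ∧ m' h = m g)
    (hHG : ∀ h : H, ∃ g : G, (∀ x : X, g • x = h • x) ∧ m g = m' h) (nsq : X → ℝ) (x : X) :
    IsSemistable nsq m x ↔ IsSemistable nsq m' x := by
  rw [IsSemistable, IsSemistable, orbit_eq_of_forall_exists_smul_eq (H := H)
    (fun g => (hGH g).imp fun _ h => h.1) (fun h => (hHG h).imp fun _ h => h.1)]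
  refine exists_congr fun z => and_congr_right fun _ => ?_
  simp only [kempfNess, map_one, one_smul]
  constructor
  · intro H h
    obtain ⟨g, hg, hm⟩ := hHG h
    rw [← hg, ← hm]; exact H g
  · intro H g
    obtain ⟨h, hg, hm⟩ := hGH g
    rw [← hg, ← hm]; exact H h

end Comparison

/-! ### Stabilizers in `G_v` and in the determinant-one subgroup. -/

section Stabilizers

variable {Q : Type*} {v : Q → ℕ}

theorem prod_det_scalarHom [Fintype Q] (c : ℂˣ) :
    ∏ j, (scalarHom v c j).det = c ^ ∑ j, v j := by
  rw [← Finset.prod_pow_eq_pow_sum]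
  refine Finset.prod_congr rfl fun j _ => Units.ext ?_
  change (Matrix.scalar (Fin (v j)) (c : ℂ)).det = _
  simp

/-- Take `c` a root of order `∑ v_j` of the inverse of the product of determinants. Hence the
determinant-one subgroup realises every transformation of `GL_v`. -/
theorem exists_scalarHom_mul_mem_detOne [Fintype Q] (g : GLv v) : ∃ c, scalarHom v c * g ∈ detOne v := by
  by_cases hv : ∑ j, v j = 0
  · have hv' (j : Q) : v j = 0 := Finset.sum_eq_zero_iff.1 hv j (Finset.mem_univ j)
    refine ⟨1, ?_⟩
    convert one_mem (detOne v)
    exact funext fun j => Units.ext (Matrix.ext fun i => absurd i.2 (by simp [hv' j]))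
  · obtain ⟨z, hz⟩ := IsAlgClosed.exists_pow_nat_eq ((∏ j, (g j).det)⁻¹ : ℂˣ).val
      (Nat.pos_of_ne_zero hv)
    have hz0 : z ≠ 0 := by
      rintro rfl
      rw [zero_pow hv] at hz
      exact (Units.ne_zero _) hz.symm
    refine ⟨Units.mk0 z hz0, ?_⟩
    change ∏ j, ((scalarHom v (Units.mk0 z hz0) j) * g j).det = 1
    simp only [map_mul]
    rw [Finset.prod_mul_distrib, prod_det_scalarHom,
      show Units.mk0 z hz0 ^ ∑ j, v j = (∏ j, (g j).det)⁻¹ from Units.ext (by simpa using hz),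
      inv_mul_cancel]

variable [Quiver Q]

theorem finite_stabilizer_Gv {φ : QRep v} (h : MulAction.stabilizer (GLv v) φ ≤ scalars v) :
    Finite (MulAction.stabilizer (Gv v) φ) := by
  have h1 : ∀ q : MulAction.stabilizer (Gv v) φ, q = 1 := by
    rintro ⟨q, hq⟩
    obtain ⟨g, rfl⟩ := QuotientGroup.mk_surjective q
    exact Subtype.ext ((QuotientGroup.eq_one_iff g).2 (h hq))
  have : Subsingleton (MulAction.stabilizer (Gv v) φ) := ⟨fun a b => (h1 a).trans (h1 b).symm⟩
  infer_instance

variable [Fintype Q]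

/-- A scalar `c` of determinant one satisfies `c ^ ∑ v_j = 1`, so it is a root of unity of bounded
order unless `v = 0`. -/
theorem finite_stabilizer_detOne {φ : QRep v} (h : MulAction.stabilizer (GLv v) φ ≤ scalars v) :
    Finite (MulAction.stabilizer (detOne v) φ) := by
  by_cases hv : ∑ j, v j = 0
  · have hv' (j : Q) : v j = 0 := Finset.sum_eq_zero_iff.1 hv j (Finset.mem_univ j)
    have : Subsingleton (MulAction.stabilizer (detOne v) φ) :=
      ⟨fun a b => Subtype.ext (Subtype.ext (funext fun j => Units.ext (Matrix.ext fun i =>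
        absurd i.2 (by simp [hv' j]))))⟩
    infer_instance
  · have : NeZero (∑ j, v j) := ⟨hv⟩
    have hfin : ((fun c : rootsOfUnity (∑ j, v j) ℂ => scalarHom v c) '' Set.univ).Finite :=
      Set.finite_univ.image _
    have hmem (a : MulAction.stabilizer (detOne v) φ) :
        (a.1.1 : GLv v) ∈ (fun c : rootsOfUnity (∑ j, v j) ℂ => scalarHom v c) '' Set.univ := by
      obtain ⟨c, hc⟩ := h (show a.1.1 ∈ MulAction.stabilizer (GLv v) φ from a.2)
      refine ⟨⟨c, ?_⟩, Set.mem_univ _, hc⟩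
      rw [mem_rootsOfUnity, ← prod_det_scalarHom, hc]
      exact a.1.2
    have := hfin.to_subtype
    exact Finite.of_injective (fun a => (⟨a.1.1, hmem a⟩ :
      ((fun c : rootsOfUnity (∑ j, v j) ℂ => scalarHom v c) '' Set.univ))) fun a b hab =>
        Subtype.ext (Subtype.ext (by simpa using hab))

/-- If a proper nonzero standard graded subspace and its complement are both preserved, the
representation is fixed by a one-parameter group of determinant one that is injective modulo
scalars. -/
theorem exists_oneParameter_stabilizer {x : QRep v}
    (u : ∀ j : Q, Matrix.unitaryGroup (Fin (v j)) ℂ) (d : Q → ℕ) (hd : ∀ j, d j ≤ v j)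
    (h₁ : ∀ p : Entry v, d p.2.1 ≤ p.2.2.2.1 → (p.2.2.2.2 : ℕ) < d p.1 →
      entry (unitaryV u • x) p = 0)
    (h₂ : ∀ p : Entry v, (p.2.2.2.1 : ℕ) < d p.2.1 → d p.1 ≤ p.2.2.2.2 →
      entry (unitaryV u • x) p = 0)
    (hpos : ∃ j, 0 < d j) (hlt : ∃ j, d j < v j) :
    ∃ γ : ℝ → GLv v, (∀ s, γ s ∈ detOne v) ∧ (∀ s, γ s • x = x) ∧
      Function.Injective fun s => (QuotientGroup.mk (γ s) : Gv v) := by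
  set N : ℝ := ∑ j, (v j : ℝ) with hN
  set D : ℝ := ∑ j, (d j : ℝ) with hD
  -- The weights `N - D` on `D` coordinates and `-D` on the other `N - D` have total zero, whence
  -- determinant one; their difference `N` is nonzero, whence injectivity modulo scalars.
  let t (s : ℝ) (j : Q) (i : Fin (v j)) : ℝ := if (i : ℕ) < d j then s * (N - D) else s * (-D)
  have hfix (s : ℝ) : expDiagV (t s) • (unitaryV u • x) = unitaryV u • x := by
    have hentry : ∀ p, entry (expDiagV (t s) • (unitaryV u • x)) p = entry (unitaryV u • x) p := by
      intro p
      rw [entry_expDiagV_smul]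
      by_cases hi : (p.2.2.2.1 : ℕ) < d p.2.1 <;> by_cases hk : (p.2.2.2.2 : ℕ) < d p.1
      · simp [entryWeight, t, hi, hk]
      · rw [h₂ p hi (not_lt.1 hk), mul_zero]
      · rw [h₁ p (not_lt.1 hi) hk, mul_zero]
      · simp [entryWeight, t, hi, hk]
    exact funext fun a => funext fun b => funext fun γ => Matrix.ext fun i k =>
      hentry ⟨a, b, γ, i, k⟩
  have hsum (s : ℝ) : ∑ j, ∑ i, t s j i = 0 := by
    have (j : Q) : ∑ i, t s j i = d j * (s * N) + v j * (s * (-D)) := by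
      have h (i : Fin (v j)) : t s j i = (if (i : ℕ) < d j then s * N else 0) + s * (-D) := by
        simp only [t]; split_ifs <;> ring
      simp only [h, Finset.sum_add_distrib, Finset.sum_ite, Finset.sum_const_zero, add_zero,
        Finset.sum_const, nsmul_eq_mul, Fin.card_filter_val_lt, min_eq_right (hd j),
        Finset.card_univ, Fintype.card_fin]
    simp only [this, Finset.sum_add_distrib, ← Finset.sum_mul]
    rw [← hN, ← hD]; ring
  refine ⟨fun s => (unitaryV u)⁻¹ * expDiagV (t s) * unitaryV u, fun s => ?_, fun s => ?_, ?_⟩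
  · change ∏ j, ((unitaryV u j)⁻¹ * expDiagV (t s) j * unitaryV u j).det = 1
    have (j : Q) : ((unitaryV u j)⁻¹ * expDiagV (t s) j * unitaryV u j).det =
        (expDiagV (t s) j).det := by
      rw [map_mul, map_mul, map_inv, mul_comm, mul_inv_cancel_left]
    simp only [this]
    refine Units.ext ?_
    rw [Units.coe_prod]
    have h2 (j : Q) : ((expDiagV (t s) j).det : ℂ) = (Real.exp (∑ i, t s j i) : ℂ) :=
      det_expDiag (t s j)
    simp only [h2]
    rw [← Complex.ofReal_prod, ← Real.exp_sum, hsum]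
    simp
  · change ((unitaryV u)⁻¹ * expDiagV (t s) * unitaryV u) • x = x
    rw [mul_smul, mul_smul, hfix, inv_smul_smul]
  · intro s r hsr
    obtain ⟨c, hc⟩ := QuotientGroup.eq.1 hsr
    have hc' : expDiagV (t r) = expDiagV (t s) * scalarHom v c := by
      have h1 : scalarHom v c = (unitaryV u)⁻¹ * ((expDiagV (t s))⁻¹ * expDiagV (t r)) *
          unitaryV u := by rw [hc]; group
      have h2 : scalarHom v c = (expDiagV (t s))⁻¹ * expDiagV (t r) := by
        have h3 : unitaryV u * scalarHom v c =
            ((expDiagV (t s))⁻¹ * expDiagV (t r)) * unitaryV u := by rw [h1]; group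
        rw [scalarHom_comm] at h3
        exact mul_right_cancel h3
      rw [h2, mul_inv_cancel_left]
    have hdiag (j : Q) (i : Fin (v j)) :
        (Real.exp (t r j i) : ℂ) = Real.exp (t s j i) * (c : ℂ) := by
      have h1 : (expDiagV (t r) j).val i i =
          ((expDiagV (t s) j).val * (scalarHom v c j).val) i i := by rw [hc']; rfl
      change Matrix.diagonal (fun i => (Real.exp (t r j i) : ℂ)) i i =
        (Matrix.diagonal (fun i => (Real.exp (t s j i) : ℂ)) *
          Matrix.diagonal (fun _ => (c : ℂ)) : Matrix _ _ ℂ) i i at h1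
      simpa only [Matrix.diagonal_mul_diagonal, Matrix.diagonal_apply_eq] using h1
    obtain ⟨j, hj⟩ := hpos
    obtain ⟨l, hl⟩ := hlt
    -- Compare one coordinate inside the subspace with one outside; the unknown scalar `c` cancels.
    have e1 := hdiag j ⟨0, hj.trans_le (hd j)⟩
    have e2 := hdiag l ⟨d l, hl⟩
    simp only [t, hj, if_true, lt_irrefl, if_false] at e1 e2
    have e3 : Real.exp (r * (N - D)) * Real.exp (s * (-D)) =
        Real.exp (s * (N - D)) * Real.exp (r * (-D)) := by
      have : (Real.exp (r * (N - D)) * Real.exp (s * (-D)) : ℂ) =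
        Real.exp (s * (N - D)) * Real.exp (r * (-D)) := by rw [e1, e2]; ring
      exact_mod_cast this
    rw [← Real.exp_add, ← Real.exp_add, Real.exp_eq_exp] at e3
    have hNpos : 0 < N := by
      have h1 : (0 : ℝ) < v l := by exact_mod_cast (Nat.zero_le _).trans_lt hl
      exact h1.trans_le (Finset.single_le_sum (f := fun j => (v j : ℝ))
        (fun _ _ => Nat.cast_nonneg _) (Finset.mem_univ l))
    have e4 : r * N = s * N := by linarith
    exact (mul_right_cancel₀ hNpos.ne' e4).symm

end Stabilizers

/-! ### The criterion for both groups. -/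

section Main

variable {Q : Type*} {v : Q → ℕ} [Quiver Q] [Fintype Q] [∀ a b : Q, Fintype (a ⟶ b)]

/-- King's criterion, for a group with the same transformations and moduli as `GL_v`. -/
theorem isStable_iff_subrepsNeg {G : Type*} [Group G] [MulAction G (QRep v)] {m : G →* ℝ}
    {θ : Q → ℝ} (hθ : ∑ j, θ j * v j = 0)
    (hG : ∀ g : G, ∃ h : GLv v, (∀ x : QRep v, h • x = g • x) ∧ modulus v θ h = m g)
    (hGL : ∀ h : GLv v, ∃ g : G, (∀ x : QRep v, g • x = h • x) ∧ m g = modulus v θ h)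
    (hfin : ∀ x : QRep v, MulAction.stabilizer (GLv v) x ≤ scalars v →
      Finite (MulAction.stabilizer G x))
    (hinf : ∀ (x : QRep v) (γ : ℝ → GLv v), (∀ s, γ s ∈ detOne v) → (∀ s, γ s • x = x) →
      (Function.Injective fun s => (QuotientGroup.mk (γ s) : Gv v)) →
        Infinite (MulAction.stabilizer G x)) (φ : QRep v) :
    IsStable normSq m φ ↔ SubrepsNeg θ φ := by
  have hss := isSemistable_iff_of_forall_exists_smul_eq hG hGL (normSq : QRep v → ℝ)
  have horb := orbit_eq_of_forall_exists_smul_eq (fun g => (hG g).imp fun _ h => h.1)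
    (fun h => (hGL h).imp fun _ h => h.1)
  have hclosed (h : IsSemistable normSq m φ) := isClosed_preimage_val_iff_of_subset
    (P := fun x => IsSemistable normSq m x) (S := MulAction.orbit G φ)
    (by rintro _ ⟨g, rfl⟩; exact h.smul g)
  constructor
  · rintro ⟨hsemi, hcl, hstab⟩ W hW hbot htop
    obtain ⟨z, hz, hmin⟩ := (hss φ).1 hsemi
    have hzss : IsSemistable normSq m z :=
      (hss z).2 ⟨z, subset_closure (MulAction.mem_orbit_self z), hmin⟩
    -- The minimal point is itself semistable, so closedness puts it in the orbit of `φ`; its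
    -- subrepresentations are then the translates of those of `φ`, and its stabilizer is finite.
    have hzorb := (hclosed hsemi).1 hcl z hzss (by rwa [horb])
    have hzfin : Finite (MulAction.stabilizer G z) :=
      Finite.of_equiv _ (MulAction.stabilizerEquivStabilizerOfOrbitRel
        (MulAction.orbitRel_apply.2 hzorb)).symm.toEquiv
    rw [horb] at hzorb
    obtain ⟨g, rfl⟩ := hzorb
    obtain ⟨u, hu⟩ := exists_unitaryV_entry_eq_zero (isSubrep_map_smul hW g)
    simp only [finrank_map_mulVecLin] at hu
    have hd (j : Q) : Module.finrank ℂ (W j) ≤ v j :=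
      (Submodule.finrank_le _).trans_eq (Module.finrank_fin_fun ℂ)
    obtain ⟨hle, hcompl⟩ := sum_nonpos_of_kempfNess_min θ _ hmin u
      (fun j => Module.finrank ℂ (W j)) hd hu
    refine lt_of_le_of_ne hle fun h0 => ?_
    obtain ⟨γ, h1, h2, h3⟩ := exists_oneParameter_stabilizer u
      (fun j => Module.finrank ℂ (W j)) hd hu (hcompl h0)
      (by
        by_contra! hn
        exact hbot (funext fun j => Submodule.finrank_eq_zero.1 (Nat.le_zero.1 (hn j))))
      (by
        by_contra! hn
        exact htop (funext fun j => Submodule.eq_top_of_finrank_eq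
          (by rw [Module.finrank_fin_fun]; exact le_antisymm (hd j) (hn j))))
    have := hinf _ γ h1 h2 h3
    exact not_finite (MulAction.stabilizer G (g • φ))
  · intro hφ
    have hsemi : IsSemistable normSq m φ := by
      rw [hss]
      obtain ⟨g, hg⟩ := exists_kempfNess_min hθ hφ
      exact ⟨g • φ, subset_closure (MulAction.mem_orbit φ g),
        (kempfNess_smul_min_iff normSq (modulus v θ) φ g).2 hg⟩
    refine ⟨hsemi, (hclosed hsemi).2 fun y hy hcl => ?_, hfin φ (stabilizer_le_scalars hθ hφ)⟩
    rw [horb] at hcl ⊢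
    exact mem_orbit_of_mem_closure hθ hφ ((hss y).1 hy) hcl

theorem isStable_Gv_iff {θ : Q → ℝ} (hθ : ∑ j, θ j * v j = 0) (φ : QRep v) :
    IsStable normSq (modulusGv v θ hθ) φ ↔ SubrepsNeg θ φ := by
  refine isStable_iff_subrepsNeg hθ (fun q => ?_)
    (fun h => ⟨QuotientGroup.mk h, fun x => mk_smul v h x, rfl⟩)
    (fun x => finite_stabilizer_Gv) (fun x γ _ h2 h3 => ?_) φ
  · obtain ⟨g, rfl⟩ := QuotientGroup.mk_surjective q
    exact ⟨g, fun x => (mk_smul v g x).symm, rfl⟩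
  · exact Infinite.of_injective (fun s => (⟨QuotientGroup.mk (γ s), h2 s⟩ :
      MulAction.stabilizer (Gv v) x)) fun s r h => h3 (congrArg Subtype.val h)

theorem isStable_detOne_iff {θ : Q → ℝ} (hθ : ∑ j, θ j * v j = 0) (φ : QRep v) :
    IsStable normSq (modulusDetOne v θ) φ ↔ SubrepsNeg θ φ := by
  refine isStable_iff_subrepsNeg hθ (fun g => ⟨g.1, fun x => rfl, rfl⟩) (fun h => ?_)
    (fun x => finite_stabilizer_detOne) (fun x γ h1 h2 h3 => ?_) φ
  · obtain ⟨c, hc⟩ := exists_scalarHom_mul_mem_detOne h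
    refine ⟨⟨_, hc⟩, fun x => ?_, ?_⟩
    · change (scalarHom v c * h) • x = h • x
      rw [mul_smul, scalarHom_smul]
    · change modulus v θ (scalarHom v c * h) = modulus v θ h
      rw [map_mul, modulus_scalarHom v θ hθ, one_mul]
  · exact Infinite.of_injective (fun s => (⟨⟨γ s, h1 s⟩, h2 s⟩ :
      MulAction.stabilizer (detOne v) x)) fun s r h =>
        h3 (congrArg (fun y => (QuotientGroup.mk y.1.1 : Gv v)) h)

end Main
end KingReal

theorem mainTheorem2 {Ω₀ : Type*} [Fintype Ω₀] [Quiver Ω₀] [∀ a b : Ω₀, Fintype (a ⟶ b)]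
    (v : Quiver.Symmetrify Ω₀ → ℕ) (θ : Quiver.Symmetrify Ω₀ → ℝ)
    (hθ : ∑ j, θ j * v j = 0) (φ : KingReal.QRep v) :
    (KingReal.IsStable KingReal.normSq (KingReal.modulusGv v θ hθ) φ ↔
      ∀ W : ∀ j, Submodule ℂ (Fin (v j) → ℂ), KingReal.IsSubrep φ W → W ≠ ⊥ → W ≠ ⊤ →
        ∑ j, θ j * (Module.finrank ℂ (W j) : ℝ) < 0) ∧
    (KingReal.IsStable KingReal.normSq (KingReal.modulusDetOne v θ) φ ↔
      ∀ W : ∀ j, Submodule ℂ (Fin (v j) → ℂ), KingReal.IsSubrep φ W → W ≠ ⊥ → W ≠ ⊤ →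
        ∑ j, θ j * (Module.finrank ℂ (W j) : ℝ) < 0) :=
  ⟨KingReal.isStable_Gv_iff hθ φ, KingReal.isStable_detOne_iff hθ φ⟩
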